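/- **Conventions.** All vector spaces are real. $X$ is a locally compact Hausdorff space with Borel $\sigma$-algebra $\mathcal B$; $C_c(X)\subseteq C_0(X)$ are the real-valued continuous functions with compact support, resp. vanishing at infinity. For $f\in C_c(X)$ with $0\le f\le 1$ and $S\subseteq X$, write $f\prec S$ if $\operatorname{supp} f\subseteq S$, and $S\prec f$ if $f=1$ on $S$. A KB-space is a Banach lattice in which every increasing norm bounded net in the positive cone is norm convergent. For a KB-space $E$, $L_r(E)$ is the space of regular operators on $E$ (differences of two positive linear operators), ordered by the cone $L_r(E)^+$ of positive operators, and $E^\sim$ is the space of regular functionals on $E$. Put $\overline{L_r(E)}=L_r(E)\cup\{\infty\}$ with $\infty$ as largest element, and $\overline{L_r(E)^+}=L_r(E)^+\cup\{\infty\}$. A measure $\mu:\mathcal B\to\overline{L_r(E)^+}$ is a map with $\mu(\emptyset)=0$ and $\mu(\bigcup_n\Delta_n)=\bigvee_N\sum_{n=1}^N\mu(\Delta_n)$ in $\overline{L_r(E)}$ for pairwise disjoint $\Delta_n\in\mathcal B$; it is finite if $\mu(X)\ne\infty$. It is a regular Borel measure if $\mu(K)\neq\infty$ for compact $K$, $\mu(V)=\bigvee\{\mu(K):K\subseteq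 V\text{ compact}\}$ for open $V$, and $\mu(\Delta)=\bigwedge\{\mu(V):V\supseteq\Delta\text{ open}\}$ for $\Delta\in\mathcal B$, in $\overline{L_r(E)}$. The order integral of an elementary function $\varphi=\sum_i r_i 1_{\Delta_i}\ge0$ is $\int^{o}\varphi\,d\mu=\sum_i r_i\mu(\Delta_i)$ (with $0\cdot\infty=0$); for measurable $f:X\to[0,\infty]$ it is $\bigvee_n\int^{o}\varphi_n\,d\mu$ with elementary $\varphi_n\uparrow f$; $\mathcal L^1(\mu)$ is the set of measurable $f:X\to\mathbb R$ with $\int^{o}|f|\,d\mu\ne\infty$, and for such $f$ one sets $\int^{o} f\,d\mu=\int^{o} f^+\,d\mu-\int^{o} f^-\,d\mu$. **Theorem.** Let $X$ be a locally compact Hausdorff space, let $E$ be a KB-space, and let $\pi:C_0(X)\to L_r(E)$ be a positive linear operator. Then there is a unique regular Borel measure $\mu:\mathcal B\to\overline{L_r(E)^+}$ such that $$\pi(f)=\int^{o}_X f\,d\mu\qquad(\ast)$$ for all $f\in C_c(X)$. The measure $\mu$ is finite, and $(\ast)$ also holds for all $f\in C_0(X)$. If $V\subseteq X$ is open and non-empty,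 then $\mu(V)=\bigvee\{\pi(f):f\prec V\}$ in $L_r(E)$; if $K\subseteq X$ is compact, then $\mu(K)=\bigwedge\{\pi(f):K\prec f\}$ in $L_r(E)$. If $(\Delta_n)$ is a pairwise disjoint sequence in $\mathcal B$ and $x\in E$, then $\mu\big(\bigcup_n\Delta_n\big)x=\sum_{n}\mu(\Delta_n)x$ in the norm of $E$. Extend $\pi$ to $\mathcal L^1(\mu)$ by $(\ast)$; the bounded Borel measurable functions belong to $\mathcal L^1(\mu)$. For $x\in E$, $x'\in E^\sim$ and $\Delta\in\mathcal B$, put $\mu_{x,x'}(\Delta)=(\mu(\Delta)x,x')$. Then $\mu_{x,x'}$ is a finite signed measure whose total variation is a regular Borel measure on $X$; it is positive when $x\ge0$ and $x'\ge0$. For $f\in\mathcal L^1(\mu)$, the function $f$ is integrable with respect to every $\mu_{x,x'}$ and $$(\pi(f)x,x')=\int_X f\,d\mu_{x,x'}\qquad(x\in E,\ x'\in E^\sim);$$ moreover, $\pi(f)$ is the unique element of $L_r(E)$ for which this holds, and it is already determined by these equalities for all $x\ge0$ and $x'\ge0$. Finally, the SOT-closed linear subspaces of the bounded operators on $E$ that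 are generated by each of the following sets are equal: (1) $\{\pi(f):f\in C_c(X)\}$; (2) $\{\pi(f):f\in C_0(X)\}$; (3) $\{\pi(f):f\text{ bounded and Borel measurable}\}$; (4) $\{\pi(f):f\in\mathcal L^1(\mu)\}$; (5) $\{\mu(V):V\text{ open}\}$; (6) $\{\mu(K):K\text{ compact}\}$; (7) $\{\mu(\Delta):\Delta\in\mathcal B\}$. -/

import Mathlib

open MeasureTheory Filter Topology
open scoped NNReal ENNReal ZeroAtInfty

set_option linter.unusedSectionVars false

namespace OrderRiesz

universe u v

/-! ### Regular operators between ordered vector spaces -/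

section RegularOperators

variable (E : Type u) [AddCommGroup E] [Lattice E] [IsOrderedAddMonoid E] [Module ℝ E]
variable (F : Type v) [AddCommGroup F] [PartialOrder F] [IsOrderedAddMonoid F] [Module ℝ F]
  [PosSMulMono ℝ F]

variable {E F} in
/-- A linear map is positive if it maps the positive cone into the positive cone. -/
def IsPositiveMap (T : E →ₗ[ℝ] F) : Prop := ∀ x, 0 ≤ x → 0 ≤ T x

/-- The linear subspace of the regular operators in the space of all linear maps from `E` to `F`,
i.e. of the differences of two positive linear maps. -/
def regularSubmodule : Submodule ℝ (E →ₗ[ℝ] F) where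
  carrier := {T | ∃ P Q : E →ₗ[ℝ] F, IsPositiveMap P ∧ IsPositiveMap Q ∧ T = P - Q}
  add_mem' := by
    rintro _ _ ⟨P, Q, hP, hQ, rfl⟩ ⟨P', Q', hP', hQ', rfl⟩
    exact ⟨P + P', Q + Q', fun x hx => add_nonneg (hP x hx) (hP' x hx),
      fun x hx => add_nonneg (hQ x hx) (hQ' x hx), by abel⟩
  zero_mem' := ⟨0, 0, fun _ _ => le_rfl, fun _ _ => le_rfl, by simp⟩
  smul_mem' := by
    rintro c _ ⟨P, Q, hP, hQ, rfl⟩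
    rcases le_total 0 c with hc | hc
    · exact ⟨c • P, c • Q, fun x hx => smul_nonneg hc (hP x hx),
        fun x hx => smul_nonneg hc (hQ x hx), smul_sub c P Q⟩
    · exact ⟨(-c) • Q, (-c) • P, fun x hx => smul_nonneg (neg_nonneg.2 hc) (hQ x hx),
        fun x hx => smul_nonneg (neg_nonneg.2 hc) (hP x hx), by simp [smul_sub]; abel⟩

/-- The space `L_r(E, F)` of regular operators. -/
def RegularOp : Type (max u v) := regularSubmodule E F

noncomputable instance : AddCommGroup (RegularOp E F) :=
  inferInstanceAs (AddCommGroup (regularSubmodule E F))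

noncomputable instance : Module ℝ (RegularOp E F) :=
  inferInstanceAs (Module ℝ (regularSubmodule E F))

variable {E F}

/-- The linear map underlying a regular operator. -/
def RegularOp.toLin (T : RegularOp E F) : E →ₗ[ℝ] F := Subtype.val T

@[simp] lemma RegularOp.toLin_add (S T : RegularOp E F) : (S + T).toLin = S.toLin + T.toLin := rfl

@[simp] lemma RegularOp.toLin_sub (S T : RegularOp E F) : (S - T).toLin = S.toLin - T.toLin := rfl

@[simp] lemma RegularOp.toLin_smul (c : ℝ) (T : RegularOp E F) :
    (c • T).toLin = c • T.toLin := rfl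

@[simp] lemma RegularOp.toLin_zero : (0 : RegularOp E F).toLin = 0 := rfl

lemma RegularOp.toLin_injective :
    Function.Injective (RegularOp.toLin : RegularOp E F → E →ₗ[ℝ] F) := Subtype.val_injective

/-- The order on `L_r(E, F)`, for which the positive cone consists of the positive operators. -/
instance : PartialOrder (RegularOp E F) where
  le S T := ∀ x, 0 ≤ x → S.toLin x ≤ T.toLin x
  le_refl _ _ _ := le_rfl
  le_trans _ _ _ h h' x hx := (h x hx).trans (h' x hx)
  le_antisymm S T h h' := by
    apply RegularOp.toLin_injective
    ext x
    rw [← posPart_sub_negPart x, map_sub, map_sub,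
      (h _ (posPart_nonneg x)).antisymm (h' _ (posPart_nonneg x)),
      (h _ (negPart_nonneg x)).antisymm (h' _ (negPart_nonneg x))]

lemma RegularOp.le_iff {S T : RegularOp E F} :
    S ≤ T ↔ ∀ x, 0 ≤ x → S.toLin x ≤ T.toLin x := Iff.rfl

instance : IsOrderedAddMonoid (RegularOp E F) where
  add_le_add_left S T h U x hx := by
    simpa using h x hx

end RegularOperators

/-! ### KB-spaces and automatic continuity -/

section BanachLattice

variable {E : Type u} [NormedAddCommGroup E] [Lattice E] [IsOrderedAddMonoid E] [HasSolidNorm E]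
  [NormedSpace ℝ E] [PosSMulMono ℝ E]

/-- A Banach lattice is a KB-space if every increasing norm bounded net in its positive cone is
norm convergent. -/
def IsKBSpace (E : Type u) [NormedAddCommGroup E] [Lattice E] : Prop :=
  ∀ (ι : Type u) [Preorder ι] [IsDirectedOrder ι] [Nonempty ι] (x : ι → E),
    Monotone x → (∀ i, 0 ≤ x i) → (∃ M : ℝ, ∀ i, ‖x i‖ ≤ M) → ∃ y, Tendsto x atTop (𝓝 y)

lemma IsPositiveMap.exists_bound [CompleteSpace E] {P : E →ₗ[ℝ] E} (hP : IsPositiveMap P) :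
    ∃ C : ℝ, ∀ x, ‖P x‖ ≤ C * ‖x‖ := by
  have mono : ∀ x y, 0 ≤ x → x ≤ y → ‖P x‖ ≤ ‖P y‖ := by
    intro x y hx hxy
    have h1 : P x ≤ P y := by
      have := hP (y - x) (sub_nonneg.2 hxy)
      rwa [map_sub, sub_nonneg] at this
    apply norm_le_norm_of_abs_le_abs
    rwa [abs_of_nonneg (hP x hx), abs_of_nonneg (hP y (hx.trans hxy))]
  have key : ∃ C : ℝ, ∀ x, 0 ≤ x → ‖P x‖ ≤ C * ‖x‖ := by
    by_contra! h
    choose x hx0 hx using fun n : ℕ => h (4 ^ n)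
    have hpos : ∀ n, 0 < ‖x n‖ := by
      intro n
      rcases (norm_nonneg (x n)).eq_or_lt with h0 | h0
      · have h1 : x n = 0 := norm_eq_zero.1 h0.symm
        have h2 := hx n
        simp [h1] at h2
      · exact h0
    let y : ℕ → E := fun n => ((1 / 2 : ℝ) ^ n * ‖x n‖⁻¹) • x n
    have hc : ∀ n, 0 < (1 / 2 : ℝ) ^ n * ‖x n‖⁻¹ := fun n => by have := hpos n; positivity
    have hy0 : ∀ n, 0 ≤ y n := fun n => smul_nonneg (hc n).le (hx0 n)
    have hyn : ∀ n, ‖y n‖ = (1 / 2 : ℝ) ^ n := by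
      intro n
      rw [norm_smul, Real.norm_of_nonneg (hc n).le, mul_assoc, inv_mul_cancel₀ (hpos n).ne',
        mul_one]
    have hys : Summable y := by
      apply Summable.of_norm
      simp only [hyn]
      exact summable_geometric_of_lt_one (by norm_num) (by norm_num)
    have hbig : ∀ n, (2 : ℝ) ^ n < ‖P (y n)‖ := by
      intro n
      rw [map_smul, norm_smul, Real.norm_of_nonneg (hc n).le]
      calc (2 : ℝ) ^ n = ((1 / 2 : ℝ) ^ n * ‖x n‖⁻¹) * (4 ^ n * ‖x n‖) := by
            rw [mul_mul_mul_comm, inv_mul_cancel₀ (hpos n).ne', ← mul_pow]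
            norm_num
        _ < _ := mul_lt_mul_of_pos_left (hx n) (hc n)
    obtain ⟨n, hn⟩ := pow_unbounded_of_one_lt ‖P (∑' n, y n)‖ (one_lt_two : (1 : ℝ) < 2)
    exact absurd ((hn.trans (hbig n)).trans_le
      (mono _ _ (hy0 n) (hys.le_tsum n fun j _ => hy0 j))) (lt_irrefl _)
  obtain ⟨C, hC⟩ := key
  refine ⟨2 * max C 0, fun x => ?_⟩
  have h1 : ‖P |x|‖ ≤ max C 0 * ‖x‖ := by
    refine (hC _ (abs_nonneg x)).trans ?_
    rw [norm_abs_eq_norm]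
    exact mul_le_mul_of_nonneg_right (le_max_left _ _) (norm_nonneg x)
  have h2 : ‖P x⁺‖ ≤ ‖P |x|‖ := mono _ _ (posPart_nonneg x) (by
    rw [← posPart_add_negPart]; exact le_add_of_nonneg_right (negPart_nonneg x))
  have h3 : ‖P x⁻‖ ≤ ‖P |x|‖ := mono _ _ (negPart_nonneg x) (by
    rw [← posPart_add_negPart]; exact le_add_of_nonneg_left (posPart_nonneg x))
  calc ‖P x‖ = ‖P x⁺ - P x⁻‖ := by rw [← map_sub, posPart_sub_negPart]
    _ ≤ ‖P x⁺‖ + ‖P x⁻‖ := norm_sub_le _ _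
    _ ≤ 2 * max C 0 * ‖x‖ := by linarith

lemma RegularOp.continuous [CompleteSpace E] (T : RegularOp E E) : Continuous T.toLin := by
  obtain ⟨P, Q, hP, hQ, h⟩ := T.2
  obtain ⟨C, hC⟩ := hP.exists_bound
  obtain ⟨D, hD⟩ := hQ.exists_bound
  have : T.toLin = P - Q := h
  rw [this]
  exact (AddMonoidHomClass.continuous_of_bound P C hC).sub
    (AddMonoidHomClass.continuous_of_bound Q D hD)

/-- A regular operator on a Banach lattice as a bounded operator, in the space of all bounded
operators on `E` with the strong operator topology. -/
noncomputable def RegularOp.toSOT [CompleteSpace E] (T : RegularOp E E) : E →Lₚₜ[ℝ] E :=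
  ContinuousLinearMap.toPointwiseConvergenceCLM ℝ (RingHom.id ℝ) E E ⟨T.toLin, T.continuous⟩

lemma RegularOp.toSOT_apply [CompleteSpace E] (T : RegularOp E E) (x : E) :
    T.toSOT x = T.toLin x := rfl

/-- The SOT-closed linear subspace of the bounded operators on `E` generated by a set of regular
operators. -/
noncomputable def sotSpan [CompleteSpace E] (S : Set (RegularOp E E)) : Submodule ℝ (E →Lₚₜ[ℝ] E) :=
  (Submodule.span ℝ (RegularOp.toSOT '' S)).topologicalClosure

end BanachLattice

/-! ### Measures with values in the extended positive cone of an ordered vector space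

For an ordered vector space `F`, the extension `F ∪ {∞}` is `WithTop F`. -/

section Measures

variable {X : Type u} {F : Type v} [AddCommGroup F] [PartialOrder F] [IsOrderedAddMonoid F]
  [Module ℝ F]

/-- A positive measure with values in `F ∪ {∞}`. As for Mathlib's vector measures, the value at
non-measurable sets is set to `0`. -/
structure PosMeasure (X : Type u) [MeasurableSpace X] (F : Type v) [AddCommGroup F]
    [PartialOrder F] where
  toFun : Set X → WithTop F
  nonneg' : ∀ Δ, 0 ≤ toFun Δ
  empty' : toFun ∅ = 0
  not_measurable' : ∀ Δ, ¬ MeasurableSet Δ → toFun Δ = 0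
  iUnion' : ∀ Δ : ℕ → Set X, (∀ n, MeasurableSet (Δ n)) →
    Pairwise (fun i j => Disjoint (Δ i) (Δ j)) →
    IsLUB (Set.range fun N : ℕ => ∑ n ∈ Finset.range N, toFun (Δ n)) (toFun (⋃ n, Δ n))

namespace PosMeasure

variable [MeasurableSpace X]

instance : CoeFun (PosMeasure X F) fun _ => Set X → WithTop F := ⟨toFun⟩

/-- The measure is finite. -/
def IsFinite (μ : PosMeasure X F) : Prop := μ Set.univ ≠ ⊤

/-- The value `μ(Δ)` as an element of `F`; only meaningful if `μ(Δ)` is finite. -/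
def val (μ : PosMeasure X F) (Δ : Set X) : F := (μ Δ).untopD 0

/-- A regular Borel measure: finite at compact sets, inner regular at open sets, and outer regular
at Borel sets. -/
structure IsRegularBorel [TopologicalSpace X] (μ : PosMeasure X F) : Prop where
  finite_of_isCompact : ∀ K, IsCompact K → μ K ≠ ⊤
  innerRegular : ∀ V, IsOpen V → IsLUB {y | ∃ K, IsCompact K ∧ K ⊆ V ∧ y = μ K} (μ V)
  outerRegular : ∀ Δ, MeasurableSet Δ → IsGLB {y | ∃ V, IsOpen V ∧ Δ ⊆ V ∧ y = μ V} (μ Δ)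

open Classical in
/-- The action of the non-negative real numbers on `F ∪ {∞}`, with `0 · ∞ = 0`. -/
noncomputable def extSMul (r : ℝ≥0) : WithTop F → WithTop F
  | ⊤ => if r = 0 then 0 else ⊤
  | (y : F) => (((r : ℝ) • y : F) : WithTop F)

/-- The order integral of an elementary function. -/
noncomputable def elemIntegral (μ : PosMeasure X F) (φ : SimpleFunc X ℝ≥0) : WithTop F :=
  ∑ r ∈ φ.range, extSMul r (μ (φ ⁻¹' {r}))

/-- `y` is the order integral of `f : X → [0, ∞]`: it is the supremum in `F ∪ {∞}` of the
integrals of a sequence of elementary functions that increases pointwise to `f`. -/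
def HasOrderIntegral (μ : PosMeasure X F) (f : X → ℝ≥0∞) (y : WithTop F) : Prop :=
  ∃ φ : ℕ → SimpleFunc X ℝ≥0, Monotone φ ∧ (∀ x, ⨆ n, (φ n x : ℝ≥0∞) = f x) ∧
    IsLUB (Set.range fun n => μ.elemIntegral (φ n)) y

open Classical in
/-- The order integral of a function `f : X → [0, ∞]`. -/
noncomputable def lintegral (μ : PosMeasure X F) (f : X → ℝ≥0∞) : WithTop F :=
  if h : ∃ y, μ.HasOrderIntegral f y then h.choose else ⊤

/-- The space `𝓛¹(X, μ; ℝ)` of measurable functions `f : X → ℝ` for which the order integral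
of `|f|` is finite. -/
def L1 (μ : PosMeasure X F) : Set (X → ℝ) :=
  {f | Measurable f ∧ μ.lintegral (fun x => ENNReal.ofReal |f x|) ≠ ⊤}

/-- The order integral of a function in `𝓛¹(X, μ; ℝ)`, as the difference of the order integrals of
the positive and the negative part. -/
noncomputable def integral (μ : PosMeasure X F) (f : X → ℝ) : F :=
  (μ.lintegral fun x => ENNReal.ofReal (f x)).untopD 0 -
    (μ.lintegral fun x => ENNReal.ofReal (-f x)).untopD 0

/-- The measure represents `π : C₀(X) → F` on the functions with compact support. -/
def Represents [TopologicalSpace X] (μ : PosMeasure X F) (π : C₀(X, ℝ) →ₗ[ℝ] F) : Prop :=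
  ∀ f : C₀(X, ℝ), HasCompactSupport f → ⇑f ∈ μ.L1 ∧ π f = μ.integral f

end PosMeasure

end Measures

section Precedes

variable {X : Type u} [TopologicalSpace X]

/-- `f ≺ S`. -/
def PrecedesSet (f : C₀(X, ℝ)) (S : Set X) : Prop :=
  HasCompactSupport f ∧ (∀ x, 0 ≤ f x ∧ f x ≤ 1) ∧ tsupport f ⊆ S

/-- `S ≺ f`. -/
def SetPrecedes (S : Set X) (f : C₀(X, ℝ)) : Prop :=
  HasCompactSupport f ∧ (∀ x, 0 ≤ f x ∧ f x ≤ 1) ∧ ∀ x ∈ S, f x = 1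

end Precedes

end OrderRiesz

open OrderRiesz

/-! The operator statement is reduced to the scalar Riesz theorem through the pairings `(Tx, x')`
with `x ≥ 0` and `x' ≥ 0`. Two facts make these pairings as good as the operators.

First, the positive cone of `E` is closed, so by Hahn–Banach positive functionals determine the
order. Hence equalities, inequalities, suprema and infima that hold under all positive pairings hold
in `L_r(E)`.

Second, the converse for suprema, which fails for arbitrary sets, holds for directed ones. In a
KB-space an upwards directed, pointwise norm bounded set of positive operators converges strongly.
The limit is the supremum, and so the supremum passes to every pairing. Infima of downwards directed
sets of positive operators behave likewise.

For existence, take the Riesz recipe in `L_r(E)`: the supremum of `π(f)` over `f ≺ V` for open `V`,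
then the infimum over open supersets. Both families are directed, so the pairing of the value at `A`
is the value at `A` of the scalar Riesz measure of `f ↦ (π(f)x, x')`. Additivity and regularity are
therefore inherited from scalar measures (`exists_operator_values`, `exists_posMeasure`). Order
integrals pair to Lebesgue integrals by monotone convergence (`functional_integral`), and truncation
extends the formula from `C_c(X)` to `C₀(X)`.

Uniqueness is scalar uniqueness, once a representing measure is known to be finite and its scalar
measures regular; both follow from operator regularity. Arbitrary `x` and `x'` are handled by
decomposing into positive parts, and by dominating `|μ_{x,x'}|` by the measure of one positive pair.
The subspaces coincide because all suprema and infima involved are strong limits. -/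

namespace OrderRiesz

/-! ### Monotone convergence in KB-spaces -/

section KBSpaces

variable {E : Type*} [NormedAddCommGroup E] [Lattice E] [IsOrderedAddMonoid E] [HasSolidNorm E]

lemma norm_le_norm_of_nonneg_of_le {x y : E} (hx : 0 ≤ x) (hxy : x ≤ y) : ‖x‖ ≤ ‖y‖ := by
  apply norm_le_norm_of_abs_le_abs
  rwa [abs_of_nonneg hx, abs_of_nonneg (hx.trans hxy)]

/-- In a KB-space, monotone norm bounded nets in the positive cone converge, irrespective of the
universe of the index set. -/
lemma IsKBSpace.exists_tendsto (hE : IsKBSpace E) {ι : Type*} [Preorder ι] [IsDirectedOrder ι]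
    [Nonempty ι] {u : ι → E} (hu : Monotone u) (hu0 : ∀ i, 0 ≤ u i) {M : ℝ}
    (hM : ∀ i, ‖u i‖ ≤ M) : ∃ y, Tendsto u atTop (𝓝 y) := by
  -- `IsKBSpace` only admits index sets in the universe of `E`. The range of `u`, ordered as a
  -- subset of `E`, is such a set, and its inclusion into `E` is a monotone net with the same limit.
  have : IsDirectedOrder (Set.range u) := ⟨by
    rintro ⟨_, i, rfl⟩ ⟨_, j, rfl⟩
    obtain ⟨k, hik, hjk⟩ := exists_ge_ge i j
    exact ⟨⟨u k, k, rfl⟩, hu hik, hu hjk⟩⟩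
  have : Nonempty (Set.range u) := (Set.range_nonempty u).to_subtype
  obtain ⟨y, hy⟩ := hE (Set.range u) (fun s => s.1) (fun _ _ h => h)
    (by rintro ⟨_, i, rfl⟩; exact hu0 i) ⟨M, by rintro ⟨_, i, rfl⟩; exact hM i⟩
  refine ⟨y, tendsto_def.2 fun V hV => ?_⟩
  obtain ⟨⟨_, i, rfl⟩, hi⟩ := mem_atTop_sets.1 (hy hV)
  exact mem_atTop_sets.2 ⟨i, fun j hj => hi ⟨u j, j, rfl⟩ (hu hj)⟩

end KBSpaces

/-! ### Positive functionals and the order they determine -/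

section Functionals

variable {E : Type*} [NormedAddCommGroup E] [Lattice E] [IsOrderedAddMonoid E] [HasSolidNorm E]
  [NormedSpace ℝ E] [PosSMulMono ℝ E]

/-- The rank one operator `x ↦ p(x)|e|` is positive, so the automatic continuity of positive
operators applies to it. -/
lemma IsPositiveMap.exists_bound_functional [CompleteSpace E] {p : E →ₗ[ℝ] ℝ}
    (hp : IsPositiveMap p) : ∃ C : ℝ, ∀ x, ‖p x‖ ≤ C * ‖x‖ := by
  rcases subsingleton_or_nontrivial E with h | h
  · exact ⟨0, fun x => by simp [Subsingleton.elim x 0]⟩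
  obtain ⟨e, he⟩ := exists_ne (0 : E)
  have hP : IsPositiveMap (p.smulRight |e|) := fun x hx => smul_nonneg (hp x hx) (abs_nonneg e)
  obtain ⟨C, hC⟩ := hP.exists_bound
  have he' : 0 < ‖e‖ := norm_pos_iff.2 he
  refine ⟨C / ‖e‖, fun x => ?_⟩
  have := hC x
  rw [LinearMap.smulRight_apply, norm_smul, norm_abs_eq_norm] at this
  rwa [div_mul_eq_mul_div, le_div_iff₀ he']

lemma RegularOp.continuous_functional [CompleteSpace E] (x' : RegularOp E ℝ) :
    Continuous x'.toLin := by
  obtain ⟨P, Q, hP, hQ, h⟩ := x'.2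
  obtain ⟨C, hC⟩ := hP.exists_bound_functional
  obtain ⟨D, hD⟩ := hQ.exists_bound_functional
  have : x'.toLin = P - Q := h
  rw [this]
  exact (AddMonoidHomClass.continuous_of_bound P C hC).sub
    (AddMonoidHomClass.continuous_of_bound Q D hD)

/-- A positive linear map, as a regular operator. -/
def RegularOp.ofPositive {F : Type*} [AddCommGroup F] [PartialOrder F] [IsOrderedAddMonoid F]
    [Module ℝ F] [PosSMulMono ℝ F] (P : E →ₗ[ℝ] F) (hP : IsPositiveMap P) : RegularOp E F :=
  ⟨P, P, 0, hP, fun _ _ => le_rfl, (sub_zero P).symm⟩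

/-- The positive functionals determine the order of a Banach lattice. -/
lemma le_of_forall_functional {y z : E}
    (h : ∀ x' : RegularOp E ℝ, 0 ≤ x' → x'.toLin y ≤ x'.toLin z) : y ≤ z := by
  by_contra hyz
  -- If `z - y` is outside the closed positive cone, a continuous functional that is non-negative on
  -- the cone is negative at `z - y`.
  obtain ⟨f, hf, hf'⟩ := (ProperCone.positive ℝ E).hyperplane_separation_point (x₀ := z - y)
    (by simpa using hyz)
  have hpos : IsPositiveMap f.toLinearMap := fun x hx => hf x hx
  have := h (RegularOp.ofPositive _ hpos) hpos
  have h2 : f y ≤ f z := this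
  rw [map_sub] at hf'
  linarith

lemma RegularOp.le_of_forall {S T : RegularOp E E}
    (h : ∀ (x : E) (x' : RegularOp E ℝ), 0 ≤ x → 0 ≤ x' →
      x'.toLin (S.toLin x) ≤ x'.toLin (T.toLin x)) : S ≤ T :=
  fun x hx => le_of_forall_functional fun x' hx' => h x x' hx hx'

lemma RegularOp.eq_of_forall {S T : RegularOp E E}
    (h : ∀ (x : E) (x' : RegularOp E ℝ), 0 ≤ x → 0 ≤ x' →
      x'.toLin (S.toLin x) = x'.toLin (T.toLin x)) : S = T :=
  le_antisymm (le_of_forall fun x x' hx hx' => (h x x' hx hx').le)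
    (le_of_forall fun x x' hx hx' => (h x x' hx hx').ge)

lemma RegularOp.functional_mono {x' : RegularOp E ℝ} (hx' : 0 ≤ x') {y z : E} (h : y ≤ z) :
    x'.toLin y ≤ x'.toLin z := by
  have : (0 : ℝ) ≤ x'.toLin (z - y) := hx' (z - y) (sub_nonneg.2 h)
  rwa [map_sub, sub_nonneg] at this

lemma RegularOp.apply_nonneg {T : RegularOp E E} (hT : 0 ≤ T) {x : E} (hx : 0 ≤ x) :
    0 ≤ T.toLin x := hT x hx

lemma RegularOp.functional_nonneg {x' : RegularOp E ℝ} (hx' : 0 ≤ x') {y : E} (h : 0 ≤ y) :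
    0 ≤ x'.toLin y := hx' y h

lemma RegularOp.isLUB_of_forall {S : Set (RegularOp E E)} {T : RegularOp E E}
    (h : ∀ (x : E) (x' : RegularOp E ℝ), 0 ≤ x → 0 ≤ x' →
      IsLUB ((fun R : RegularOp E E => x'.toLin (R.toLin x)) '' S) (x'.toLin (T.toLin x))) :
    IsLUB S T := by
  refine ⟨fun R hR => le_of_forall fun x x' hx hx' => (h x x' hx hx').1 ⟨R, hR, rfl⟩,
    fun U hU => le_of_forall fun x x' hx hx' => (h x x' hx hx').2 ?_⟩
  rintro _ ⟨R, hR, rfl⟩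
  exact functional_mono hx' (hU hR x hx)

lemma RegularOp.isGLB_of_forall {S : Set (RegularOp E E)} {T : RegularOp E E}
    (h : ∀ (x : E) (x' : RegularOp E ℝ), 0 ≤ x → 0 ≤ x' →
      IsGLB ((fun R : RegularOp E E => x'.toLin (R.toLin x)) '' S) (x'.toLin (T.toLin x))) :
    IsGLB S T := by
  refine ⟨fun R hR => le_of_forall fun x x' hx hx' => (h x x' hx hx').1 ⟨R, hR, rfl⟩,
    fun U hU => le_of_forall fun x x' hx hx' => (h x x' hx hx').2 ?_⟩
  rintro _ ⟨R, hR, rfl⟩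
  exact functional_mono hx' (hU hR x hx)

end Functionals

/-! ### Directed sets of operators and their strong limits -/

section DirectedSets

variable {E : Type*} [NormedAddCommGroup E] [Lattice E] [IsOrderedAddMonoid E] [HasSolidNorm E]
  [NormedSpace ℝ E] [PosSMulMono ℝ E] [CompleteSpace E]

lemma RegularOp.toSOT_sub (S T : RegularOp E E) : (S - T).toSOT = S.toSOT - T.toSOT := rfl

lemma RegularOp.mem_closure_weak {S : Set (RegularOp E E)} {T : RegularOp E E}
    (h : T.toSOT ∈ closure (RegularOp.toSOT '' S)) (x : E) (x' : RegularOp E ℝ) :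
    x'.toLin (T.toLin x) ∈ closure ((fun R : RegularOp E E => x'.toLin (R.toLin x)) '' S) := by
  have hc : Continuous fun R : E →Lₚₜ[ℝ] E => x'.toLin (R x) :=
    x'.continuous_functional.comp (continuous_eval_const x)
  have := image_closure_subset_closure_image hc ⟨_, h, rfl⟩
  rwa [Set.image_image] at this

/-- A supremum of operators need not survive pairing with `x` and `x'`. It does when it is strongly
adherent to the set, because the pairing is strongly continuous. -/
lemma RegularOp.isLUB_weak {S : Set (RegularOp E E)} {T : RegularOp E E}
    (hT : T ∈ upperBounds S) (h : T.toSOT ∈ closure (RegularOp.toSOT '' S))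
    {x : E} {x' : RegularOp E ℝ} (hx : 0 ≤ x) (hx' : 0 ≤ x') :
    IsLUB ((fun R : RegularOp E E => x'.toLin (R.toLin x)) '' S) (x'.toLin (T.toLin x)) := by
  refine isLUB_of_mem_closure ?_ (mem_closure_weak h x x')
  rintro _ ⟨R, hR, rfl⟩
  exact functional_mono hx' (hT hR x hx)

lemma RegularOp.isGLB_weak {S : Set (RegularOp E E)} {T : RegularOp E E}
    (hT : T ∈ lowerBounds S) (h : T.toSOT ∈ closure (RegularOp.toSOT '' S))
    {x : E} {x' : RegularOp E ℝ} (hx : 0 ≤ x) (hx' : 0 ≤ x') :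
    IsGLB ((fun R : RegularOp E E => x'.toLin (R.toLin x)) '' S) (x'.toLin (T.toLin x)) := by
  refine isGLB_of_mem_closure ?_ (mem_closure_weak h x x')
  rintro _ ⟨R, hR, rfl⟩
  exact functional_mono hx' (hT hR x hx)

/-- An upwards directed pointwise norm bounded set of positive operators on a KB-space converges
strongly to an upper bound. -/
lemma RegularOp.exists_upperBound_mem_closure (hE : IsKBSpace E) {S : Set (RegularOp E E)}
    (hne : S.Nonempty) (hdir : DirectedOn (· ≤ ·) S) (h0 : ∀ T ∈ S, 0 ≤ T)
    (hb : ∀ x, 0 ≤ x → ∃ M : ℝ, ∀ T ∈ S, ‖T.toLin x‖ ≤ M) :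
    ∃ T ∈ upperBounds S, T.toSOT ∈ closure (RegularOp.toSOT '' S) := by
  have : IsDirectedOrder S := ⟨fun a b => by
    obtain ⟨c, hc, hac, hbc⟩ := hdir a.1 a.2 b.1 b.2
    exact ⟨⟨c, hc⟩, hac, hbc⟩⟩
  have : Nonempty S := hne.to_subtype
  -- The set `S` is used as a net indexed by itself. The KB property gives limits at positive
  -- vectors, and `x = x⁺ - x⁻` gives them everywhere.
  have hpos : ∀ x : E, 0 ≤ x → ∃ y, Tendsto (fun R : S => R.1.toLin x) atTop (𝓝 y) := by
    intro x hx
    obtain ⟨M, hM⟩ := hb x hx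
    exact hE.exists_tendsto (u := fun R : S => R.1.toLin x) (fun R R' h => h x hx)
      (fun R => h0 R.1 R.2 x hx) (fun R => hM R.1 R.2)
  have hall : ∀ x : E, ∃ y, Tendsto (fun R : S => R.1.toLin x) atTop (𝓝 y) := by
    intro x
    obtain ⟨y, hy⟩ := hpos _ (posPart_nonneg x)
    obtain ⟨z, hz⟩ := hpos _ (negPart_nonneg x)
    refine ⟨y - z, (hy.sub hz).congr fun R => ?_⟩
    rw [← map_sub, posPart_sub_negPart]
  choose L hL using hall
  let T : E →ₗ[ℝ] E :=
    { toFun := L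
      map_add' := fun x y => tendsto_nhds_unique (hL (x + y))
        (((hL x).add (hL y)).congr fun R => (map_add _ _ _).symm)
      map_smul' := fun c x => tendsto_nhds_unique (hL (c • x))
        (((hL x).const_smul c).congr fun R => (map_smul _ _ _).symm) }
  have hT : IsPositiveMap T := fun x hx =>
    ge_of_tendsto' (hL x) fun R => h0 R.1 R.2 x hx
  refine ⟨RegularOp.ofPositive T hT, fun R hR x hx => ?_, ?_⟩
  · refine ge_of_tendsto (hL x) ?_
    filter_upwards [eventually_ge_atTop (⟨R, hR⟩ : S)] with Q hQ
    exact hQ x hx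
  · refine mem_closure_of_tendsto (f := fun R : S => R.1.toSOT) (b := atTop)
      (PointwiseConvergenceCLM.tendsto_iff_forall_tendsto.2 hL)
      (Eventually.of_forall fun R => ⟨R.1, R.2, rfl⟩)

lemma RegularOp.isLUB_of_mem_closure {S : Set (RegularOp E E)} {T : RegularOp E E}
    (hT : T ∈ upperBounds S) (h : T.toSOT ∈ closure (RegularOp.toSOT '' S)) : IsLUB S T :=
  isLUB_of_forall fun _ _ hx hx' => isLUB_weak hT h hx hx'

/-- The supremum itself supplies the norm bounds. The resulting strong limit is also a supremum, so
the two agree. -/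
lemma RegularOp.mem_closure_of_isLUB (hE : IsKBSpace E) {S : Set (RegularOp E E)}
    (hne : S.Nonempty) (hdir : DirectedOn (· ≤ ·) S) (h0 : ∀ T ∈ S, 0 ≤ T)
    {T : RegularOp E E} (hT : IsLUB S T) : T.toSOT ∈ closure (RegularOp.toSOT '' S) := by
  obtain ⟨U, hU, hUc⟩ := exists_upperBound_mem_closure hE hne hdir h0 fun x hx =>
    ⟨‖T.toLin x‖, fun R hR => norm_le_norm_of_nonneg_of_le (h0 R hR x hx) (hT.1 hR x hx)⟩
  rwa [hT.unique (isLUB_of_mem_closure hU hUc)]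

/-- A downwards directed set of positive operators on a KB-space converges strongly to a lower
bound. -/
lemma RegularOp.exists_lowerBound_mem_closure (hE : IsKBSpace E) {S : Set (RegularOp E E)}
    (hne : S.Nonempty) (hdir : DirectedOn (· ≥ ·) S) (h0 : ∀ T ∈ S, 0 ≤ T) :
    ∃ T ∈ lowerBounds S, T.toSOT ∈ closure (RegularOp.toSOT '' S) := by
  obtain ⟨A, hA⟩ := hne
  -- Reflecting the part of `S` below a fixed `A ∈ S` gives an upwards directed set between `0` and
  -- `A`. If `U` is its strong limit, then `A - U` is the one wanted.
  let S' : Set (RegularOp E E) := {R | ∃ Q ∈ S, Q ≤ A ∧ R = A - Q}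
  obtain ⟨U, hU, hUc⟩ := exists_upperBound_mem_closure hE (S := S') ⟨A - A, A, hA, le_rfl, rfl⟩
    (by
      rintro _ ⟨Q, hQ, hQA, rfl⟩ _ ⟨Q', hQ', -, rfl⟩
      obtain ⟨P, hP, h1, h2⟩ := hdir Q hQ Q' hQ'
      exact ⟨A - P, ⟨P, hP, le_trans h1 hQA, rfl⟩, sub_le_sub_left h1 A, sub_le_sub_left h2 A⟩)
    (by rintro _ ⟨Q, hQ, hQA, rfl⟩; exact sub_nonneg.2 hQA)
    (fun x hx => ⟨‖A.toLin x‖, by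
      rintro _ ⟨Q, hQ, hQA, rfl⟩
      refine norm_le_norm_of_nonneg_of_le ?_ ?_
      · simpa using hQA x hx
      · simpa using! h0 Q hQ x hx⟩)
  refine ⟨A - U, fun R hR => ?_, ?_⟩
  · obtain ⟨P, hP, h1, h2⟩ := hdir A hA R hR
    have := hU ⟨P, hP, h1, rfl⟩
    exact le_trans (sub_le_comm.1 this) h2
  · have hc : Continuous fun R : E →Lₚₜ[ℝ] E => A.toSOT - R := continuous_const.sub continuous_id
    have := image_closure_subset_closure_image hc ⟨_, hUc, rfl⟩
    refine closure_mono ?_ this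
    rintro _ ⟨_, ⟨_, ⟨Q, hQ, -, rfl⟩, rfl⟩, rfl⟩
    exact ⟨Q, hQ, by simp [toSOT_sub]⟩

lemma RegularOp.isGLB_of_mem_closure {S : Set (RegularOp E E)} {T : RegularOp E E}
    (hT : T ∈ lowerBounds S) (h : T.toSOT ∈ closure (RegularOp.toSOT '' S)) : IsGLB S T :=
  isGLB_of_forall fun _ _ hx hx' => isGLB_weak hT h hx hx'

lemma RegularOp.mem_closure_of_isGLB (hE : IsKBSpace E) {S : Set (RegularOp E E)}
    (hne : S.Nonempty) (hdir : DirectedOn (· ≥ ·) S) (h0 : ∀ T ∈ S, 0 ≤ T)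
    {T : RegularOp E E} (hT : IsGLB S T) : T.toSOT ∈ closure (RegularOp.toSOT '' S) := by
  obtain ⟨U, hU, hUc⟩ := exists_lowerBound_mem_closure hE hne hdir h0
  rwa [hT.unique (isGLB_of_mem_closure hU hUc)]

end DirectedSets

/-! ### Suprema and infima in the extended order -/

lemma isLUB_image_coe {F : Type*} [Preorder F] {S : Set F} {T : F} :
    IsLUB ((fun y : F => (y : WithTop F)) '' S) (T : WithTop F) ↔ IsLUB S T := by
  constructor
  · refine fun h => ⟨fun y hy => WithTop.coe_le_coe.1 (h.1 ⟨y, hy, rfl⟩), fun z hz => ?_⟩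
    refine WithTop.coe_le_coe.1 (h.2 ?_)
    rintro _ ⟨y, hy, rfl⟩
    exact WithTop.coe_le_coe.2 (hz hy)
  · refine fun h => ⟨?_, fun z hz => ?_⟩
    · rintro _ ⟨y, hy, rfl⟩
      exact WithTop.coe_le_coe.2 (h.1 hy)
    · induction z using WithTop.recTopCoe with
      | top => exact le_top
      | coe z =>
        exact WithTop.coe_le_coe.2 (h.2 fun y hy => WithTop.coe_le_coe.1 (hz ⟨y, hy, rfl⟩))

/-- Non-emptiness matters: the infimum of the empty set in `WithTop F` is `⊤`. -/
lemma isGLB_image_coe {F : Type*} [Preorder F] {S : Set F} {T : F} (hS : S.Nonempty) :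
    IsGLB ((fun y : F => (y : WithTop F)) '' S) (T : WithTop F) ↔ IsGLB S T := by
  constructor
  · refine fun h => ⟨fun y hy => WithTop.coe_le_coe.1 (h.1 ⟨y, hy, rfl⟩), fun z hz => ?_⟩
    refine WithTop.coe_le_coe.1 (h.2 ?_)
    rintro _ ⟨y, hy, rfl⟩
    exact WithTop.coe_le_coe.2 (hz hy)
  · refine fun h => ⟨?_, fun z hz => ?_⟩
    · rintro _ ⟨y, hy, rfl⟩
      exact WithTop.coe_le_coe.2 (h.1 hy)
    · obtain ⟨s, hs⟩ := hS
      induction z using WithTop.recTopCoe with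
      | top => exact absurd (hz ⟨s, hs, rfl⟩) (WithTop.not_top_le_coe s)
      | coe z =>
        exact WithTop.coe_le_coe.2 (h.2 fun y hy => WithTop.coe_le_coe.1 (hz ⟨y, hy, rfl⟩))

/-! ### Finite measures and their scalar measures -/

namespace PosMeasure

section General

variable {X F : Type*} [MeasurableSpace X] [AddCommGroup F] [PartialOrder F]
  [IsOrderedAddMonoid F] [Module ℝ F]

lemma mono (μ : PosMeasure X F) {A B : Set X} (hA : MeasurableSet A) (hB : MeasurableSet B)
    (hAB : A ⊆ B) : μ A ≤ μ B := by
  let Δ : ℕ → Set X := fun n => if n = 0 then A else if n = 1 then B \ A else ∅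
  have hm : ∀ n, MeasurableSet (Δ n) := by
    intro n
    simp only [Δ]
    split_ifs
    exacts [hA, hB.diff hA, MeasurableSet.empty]
  have hd : Pairwise (fun i j => Disjoint (Δ i) (Δ j)) := by
    intro i j hij
    simp only [Δ]
    split_ifs <;> simp_all [Set.disjoint_sdiff_left, Set.disjoint_sdiff_right]
  have hU : ⋃ n, Δ n = B := by
    ext x
    simp only [Set.mem_iUnion, Δ]
    constructor
    · rintro ⟨n, hn⟩
      split_ifs at hn
      exacts [hAB hn, hn.1, hn.elim]
    · intro hx
      by_cases hxA : x ∈ A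
      · exact ⟨0, by simpa using hxA⟩
      · exact ⟨1, by simpa using ⟨hx, hxA⟩⟩
  -- The partial sum with `N = 1` is `μ A`, and it is bounded by the value at the union, `μ B`.
  have := (μ.iUnion' Δ hm hd).1 ⟨1, rfl⟩
  rw [hU] at this
  simpa [Δ] using this

lemma ne_top (μ : PosMeasure X F) (hμ : μ.IsFinite) (A : Set X) : μ A ≠ ⊤ := by
  by_cases hA : MeasurableSet A
  · exact ne_top_of_le_ne_top hμ (μ.mono hA MeasurableSet.univ (Set.subset_univ A))
  · have := μ.not_measurable' A hA
    rw [this]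
    exact WithTop.zero_ne_top

lemma coe_val (μ : PosMeasure X F) {A : Set X} (hA : μ A ≠ ⊤) : (μ.val A : WithTop F) = μ A := by
  rw [val]
  generalize μ A = y at hA ⊢
  induction y using WithTop.recTopCoe with
  | top => exact absurd rfl hA
  | coe y => rfl

lemma val_of_not_measurable (μ : PosMeasure X F) {A : Set X} (hA : ¬MeasurableSet A) :
    μ.val A = 0 := by
  rw [val, μ.not_measurable' A hA]
  rfl

lemma val_empty (μ : PosMeasure X F) : μ.val ∅ = 0 := by
  rw [val, μ.empty']
  rfl

lemma val_nonneg (μ : PosMeasure X F) (A : Set X) : 0 ≤ μ.val A := by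
  have h := μ.nonneg' A
  rw [val]
  generalize μ A = y at h ⊢
  induction y using WithTop.recTopCoe with
  | top => exact le_rfl
  | coe y => exact WithTop.coe_le_coe.1 h

lemma val_mono (μ : PosMeasure X F) (hμ : μ.IsFinite) {A B : Set X} (hA : MeasurableSet A)
    (hB : MeasurableSet B) (hAB : A ⊆ B) : μ.val A ≤ μ.val B := by
  have := μ.mono hA hB hAB
  rwa [← μ.coe_val (μ.ne_top hμ A), ← μ.coe_val (μ.ne_top hμ B), WithTop.coe_le_coe] at this

lemma isLUB_val (μ : PosMeasure X F) (hμ : μ.IsFinite) {Δ : ℕ → Set X}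
    (hm : ∀ n, MeasurableSet (Δ n)) (hd : Pairwise (fun i j => Disjoint (Δ i) (Δ j))) :
    IsLUB (Set.range fun N : ℕ => ∑ n ∈ Finset.range N, μ.val (Δ n)) (μ.val (⋃ n, Δ n)) := by
  rw [← isLUB_image_coe, ← Set.range_comp, μ.coe_val (μ.ne_top hμ _)]
  convert μ.iUnion' Δ hm hd using 3 with N
  rw [Function.comp_apply, WithTop.coe_sum]
  exact Finset.sum_congr rfl fun n _ => μ.coe_val (μ.ne_top hμ _)

lemma ext_val {μ μ' : PosMeasure X F} (hμ : μ.IsFinite) (hμ' : μ'.IsFinite)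
    (h : ∀ A, MeasurableSet A → μ.val A = μ'.val A) : μ = μ' := by
  have : μ.toFun = μ'.toFun := by
    ext A : 1
    by_cases hA : MeasurableSet A
    · have := h A hA
      rw [← WithTop.coe_inj, μ.coe_val (μ.ne_top hμ A), μ'.coe_val (μ'.ne_top hμ' A)] at this
      exact this
    · rw [μ.not_measurable' A hA, μ'.not_measurable' A hA]
  cases μ
  cases μ'
  congr

end General

variable {X : Type*} [MeasurableSpace X]
  {E : Type*} [NormedAddCommGroup E] [Lattice E] [IsOrderedAddMonoid E] [HasSolidNorm E]
  [NormedSpace ℝ E] [PosSMulMono ℝ E] [CompleteSpace E]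

lemma toLin_sum {ι : Type*} (s : Finset ι) (T : ι → RegularOp E E) (x : E) :
    (∑ i ∈ s, T i).toLin x = ∑ i ∈ s, (T i).toLin x := by
  classical
  induction s using Finset.induction_on with
  | empty => simp
  | insert a s ha ih => rw [Finset.sum_insert ha, Finset.sum_insert ha, ← ih]; rfl

/-- A finite measure is strongly σ-additive. -/
lemma hasSum_val_of_nonneg (μ : PosMeasure X (RegularOp E E)) (hE : IsKBSpace E)
    (hμ : μ.IsFinite) {Δ : ℕ → Set X} (hm : ∀ n, MeasurableSet (Δ n))
    (hd : Pairwise (fun i j => Disjoint (Δ i) (Δ j))) {x : E} (hx : 0 ≤ x) :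
    HasSum (fun n => (μ.val (Δ n)).toLin x) ((μ.val (⋃ n, Δ n)).toLin x) := by
  have hLUB := μ.isLUB_val hμ hm hd
  have h0 : ∀ n, 0 ≤ (μ.val (Δ n)).toLin x := fun n => μ.val_nonneg _ x hx
  have hfin : ∀ s : Finset ℕ, 0 ≤ ∑ n ∈ s, (μ.val (Δ n)).toLin x :=
    fun s => Finset.sum_nonneg fun n _ => h0 n
  have hle : ∀ N, ∑ n ∈ Finset.range N, (μ.val (Δ n)).toLin x ≤ (μ.val (⋃ n, Δ n)).toLin x := by
    intro N
    rw [← toLin_sum]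
    exact hLUB.1 ⟨N, rfl⟩ x hx
  have hmono : Monotone fun s : Finset ℕ => ∑ n ∈ s, (μ.val (Δ n)).toLin x :=
    fun s t hst => Finset.sum_le_sum_of_subset_of_nonneg hst fun n _ _ => h0 n
  have hle' : ∀ s : Finset ℕ, ∑ n ∈ s, (μ.val (Δ n)).toLin x ≤ (μ.val (⋃ n, Δ n)).toLin x :=
    fun s => (hmono (Finset.subset_range_sup_succ s)).trans (hle _)
  -- The net of all finite partial sums is increasing and norm bounded, which gives unconditional
  -- convergence.
  obtain ⟨y, hy⟩ := hE.exists_tendsto hmono hfin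
    fun s => norm_le_norm_of_nonneg_of_le (hfin s) (hle' s)
  have hcl := RegularOp.mem_closure_of_isLUB hE (Set.range_nonempty _)
    (by
      refine (Monotone.directed_le ?_).directedOn_range
      exact fun N M hNM => Finset.sum_le_sum_of_subset_of_nonneg
        (Finset.range_mono hNM) fun n _ _ => μ.val_nonneg _)
    (by rintro _ ⟨N, rfl⟩; exact Finset.sum_nonneg fun n _ => μ.val_nonneg _) hLUB
  have hy1 : y ≤ (μ.val (⋃ n, Δ n)).toLin x := le_of_tendsto' hy hle'
  -- The value at the union is only known as a supremum of operators. Being strongly adherent to the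
  -- partial sums, it is a supremum under each positive functional, and there it is at most `y`.
  have hy2 : (μ.val (⋃ n, Δ n)).toLin x ≤ y := by
    refine le_of_forall_functional fun x' hx' => ?_
    refine (RegularOp.isLUB_weak hLUB.1 hcl hx hx').2 ?_
    rintro _ ⟨_, ⟨N, rfl⟩, rfl⟩
    refine RegularOp.functional_mono hx' ?_
    simp only [toLin_sum]
    exact hmono.ge_of_tendsto hy _
  rw [← hy1.antisymm hy2]
  exact hy

lemma hasSum_val (μ : PosMeasure X (RegularOp E E)) (hE : IsKBSpace E)
    (hμ : μ.IsFinite) {Δ : ℕ → Set X} (hm : ∀ n, MeasurableSet (Δ n))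
    (hd : Pairwise (fun i j => Disjoint (Δ i) (Δ j))) (x : E) :
    HasSum (fun n => (μ.val (Δ n)).toLin x) ((μ.val (⋃ n, Δ n)).toLin x) := by
  have := (μ.hasSum_val_of_nonneg hE hμ hm hd (posPart_nonneg x)).sub
    (μ.hasSum_val_of_nonneg hE hμ hm hd (negPart_nonneg x))
  simpa only [← map_sub, posPart_sub_negPart] using this

/-- The signed measure `μ_{x,x'}`. -/
noncomputable def signed (μ : PosMeasure X (RegularOp E E)) (hE : IsKBSpace E) (hμ : μ.IsFinite)
    (x : E) (x' : RegularOp E ℝ) : SignedMeasure X where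
  measureOf' Δ := x'.toLin ((μ.val Δ).toLin x)
  empty' := by simp [val_empty]
  not_measurable' Δ hΔ := by simp [μ.val_of_not_measurable hΔ]
  m_iUnion' Δ hm hd := (μ.hasSum_val hE hμ hm hd x).map x'.toLin x'.continuous_functional

variable (μ : PosMeasure X (RegularOp E E)) (hE : IsKBSpace E) (hμ : μ.IsFinite)

lemma signed_apply (x : E) (x' : RegularOp E ℝ) (Δ : Set X) :
    μ.signed hE hμ x x' Δ = x'.toLin ((μ.val Δ).toLin x) := rfl

lemma signed_nonneg {x : E} {x' : RegularOp E ℝ} (hx : 0 ≤ x) (hx' : 0 ≤ x') :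
    0 ≤ μ.signed hE hμ x x' := by
  rw [VectorMeasure.le_iff]
  intro A _
  exact RegularOp.functional_nonneg hx' (RegularOp.apply_nonneg (μ.val_nonneg A) hx)

/-- The positive measure `|μ_{x,x'}|`. -/
noncomputable def weak (x : E) (x' : RegularOp E ℝ) : Measure X :=
  (μ.signed hE hμ x x').variation

instance (x : E) (x' : RegularOp E ℝ) : IsFiniteMeasure (μ.weak hE hμ x x') := by
  rw [weak, ← SignedMeasure.totalVariation_eq_variation]
  infer_instance

/-- A positive signed measure comes from a positive measure, which is its own variation. -/
lemma toSignedMeasure_weak {x : E} {x' : RegularOp E ℝ} (hx : 0 ≤ x) (hx' : 0 ≤ x') :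
    (μ.weak hE hμ x x').toSignedMeasure = μ.signed hE hμ x x' := by
  have h0 := μ.signed_nonneg hE hμ hx hx'
  rw [← VectorMeasure.le_restrict_univ_iff_le] at h0
  have h := (μ.signed hE hμ x x').toMeasureOfZeroLE_toSignedMeasure h0
  have h2 : μ.weak hE hμ x x'
      = (μ.signed hE hμ x x').toMeasureOfZeroLE Set.univ MeasurableSet.univ h0 := by
    rw [weak]
    conv_lhs => rw [← h]
    exact Measure.variation_toSignedMeasure
  refine Eq.trans ?_ h
  congr

lemma weak_real {x : E} {x' : RegularOp E ℝ} (hx : 0 ≤ x) (hx' : 0 ≤ x') {A : Set X}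
    (hA : MeasurableSet A) :
    (μ.weak hE hμ x x').real A = x'.toLin ((μ.val A).toLin x) := by
  rw [← μ.signed_apply hE hμ, ← μ.toSignedMeasure_weak hE hμ hx hx',
    Measure.toSignedMeasure_apply_measurable hA]

lemma weak_apply {x : E} {x' : RegularOp E ℝ} (hx : 0 ≤ x) (hx' : 0 ≤ x') {A : Set X}
    (hA : MeasurableSet A) :
    μ.weak hE hμ x x' A = ENNReal.ofReal (x'.toLin ((μ.val A).toLin x)) := by
  rw [← μ.weak_real hE hμ hx hx' hA, ofReal_measureReal]

end PosMeasure

/-! ### Order integrals with respect to finite measures -/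

namespace PosMeasure

variable {X : Type*} [MeasurableSpace X]
  {E : Type*} [NormedAddCommGroup E] [Lattice E] [IsOrderedAddMonoid E] [HasSolidNorm E]
  [NormedSpace ℝ E] [PosSMulMono ℝ E] [CompleteSpace E]
  (μ : PosMeasure X (RegularOp E E)) (hE : IsKBSpace E) (hμ : μ.IsFinite)

/-- The order integral of an elementary function with respect to a finite measure. -/
noncomputable def elemVal (φ : SimpleFunc X ℝ≥0) : RegularOp E E :=
  ∑ r ∈ φ.range, (r : ℝ) • μ.val (φ ⁻¹' {r})

include hμ in
lemma elemIntegral_eq (φ : SimpleFunc X ℝ≥0) : μ.elemIntegral φ = (μ.elemVal φ : WithTop _) := by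
  rw [elemIntegral, elemVal, WithTop.coe_sum]
  refine Finset.sum_congr rfl fun r _ => ?_
  rw [← μ.coe_val (μ.ne_top hμ _)]
  rfl

lemma elemVal_nonneg (φ : SimpleFunc X ℝ≥0) : 0 ≤ μ.elemVal φ :=
  Finset.sum_nonneg fun r _ x hx => smul_nonneg r.2 (μ.val_nonneg (φ ⁻¹' {r}) x hx)

/-- This is the bridge to Lebesgue integrals: properties of elementary order integrals, such as
monotonicity, can be read off from scalar ones. -/
lemma ofReal_elemVal (φ : SimpleFunc X ℝ≥0) {x : E} {x' : RegularOp E ℝ} (hx : 0 ≤ x)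
    (hx' : 0 ≤ x') :
    ENNReal.ofReal (x'.toLin ((μ.elemVal φ).toLin x)) = ∫⁻ a, φ a ∂(μ.weak hE hμ x x') := by
  have h : ∫⁻ a, φ a ∂(μ.weak hE hμ x x')
      = (φ.map fun r : ℝ≥0 => (r : ℝ≥0∞)).lintegral (μ.weak hE hμ x x') :=
    SimpleFunc.lintegral_eq_lintegral (φ.map fun r : ℝ≥0 => (r : ℝ≥0∞)) _
  rw [h, SimpleFunc.map_lintegral, elemVal, toLin_sum, map_sum, ENNReal.ofReal_sum_of_nonneg]
  · refine Finset.sum_congr rfl fun r _ => ?_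
    rw [μ.weak_apply hE hμ hx hx' (φ.measurableSet_preimage _), RegularOp.toLin_smul,
      LinearMap.smul_apply, map_smul, smul_eq_mul, ENNReal.ofReal_mul r.coe_nonneg,
      ENNReal.ofReal_coe_nnreal]
  · exact fun r _ => RegularOp.functional_nonneg hx'
      (smul_nonneg r.2 (μ.val_nonneg (φ ⁻¹' {r}) x hx))

include hE hμ in
lemma elemVal_mono : Monotone μ.elemVal := by
  intro φ ψ h
  refine RegularOp.le_of_forall fun x x' hx hx' => ?_
  rw [← ENNReal.ofReal_le_ofReal_iff (RegularOp.functional_nonneg hx'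
    (RegularOp.apply_nonneg (μ.elemVal_nonneg ψ) hx)), μ.ofReal_elemVal hE hμ φ hx hx',
    μ.ofReal_elemVal hE hμ ψ hx hx']
  exact lintegral_mono fun a => ENNReal.coe_le_coe.2 (h a)

include hμ in
lemma range_elemIntegral (φ : ℕ → SimpleFunc X ℝ≥0) :
    (Set.range fun n => μ.elemIntegral (φ n))
      = (fun T : RegularOp E E => (T : WithTop _)) '' Set.range fun n => μ.elemVal (φ n) := by
  rw [← Set.range_comp]
  exact congrArg _ (funext fun n => μ.elemIntegral_eq hμ (φ n))

include hE hμ in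
lemma toSOT_mem_closure_elemVal {φ : ℕ → SimpleFunc X ℝ≥0} (hφ : Monotone φ) {T : RegularOp E E}
    (hT : IsLUB (Set.range fun n => μ.elemVal (φ n)) T) :
    T.toSOT ∈ closure (RegularOp.toSOT '' Set.range fun n => μ.elemVal (φ n)) := by
  refine RegularOp.mem_closure_of_isLUB hE (Set.range_nonempty _)
    (Monotone.directed_le ((μ.elemVal_mono hE hμ).comp hφ)).directedOn_range ?_ hT
  rintro _ ⟨n, rfl⟩
  exact μ.elemVal_nonneg _

lemma lintegral_weak_eq_iSup {f : X → ℝ≥0∞} {φ : ℕ → SimpleFunc X ℝ≥0} (hφ : Monotone φ)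
    (hf : ∀ a, ⨆ n, (φ n a : ℝ≥0∞) = f a) {x : E} {x' : RegularOp E ℝ} (hx : 0 ≤ x)
    (hx' : 0 ≤ x') : ∫⁻ a, f a ∂(μ.weak hE hμ x x')
      = ⨆ n, ENNReal.ofReal (x'.toLin ((μ.elemVal (φ n)).toLin x)) := by
  simp_rw [← hf]
  rw [lintegral_iSup (fun n => (φ n).measurable.coe_nnreal_ennreal)
    (fun m n hmn a => ENNReal.coe_le_coe.2 (hφ hmn a))]
  exact iSup_congr fun n => (μ.ofReal_elemVal hE hμ _ hx hx').symm

/-- Monotone convergence treats the Lebesgue side and strong adherence of the supremum the operator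
side. As the left side does not involve the elementary functions, a finite order integral is
independent of the approximating sequence. -/
lemma HasOrderIntegral.lintegral_weak {f : X → ℝ≥0∞} {T : RegularOp E E}
    (h : μ.HasOrderIntegral f (T : WithTop _)) {x : E} {x' : RegularOp E ℝ} (hx : 0 ≤ x)
    (hx' : 0 ≤ x') :
    ∫⁻ a, f a ∂(μ.weak hE hμ x x') = ENNReal.ofReal (x'.toLin (T.toLin x)) := by
  obtain ⟨φ, hφ, hf, hT⟩ := h
  rw [μ.range_elemIntegral hμ, isLUB_image_coe] at hT
  have hlub := RegularOp.isLUB_weak hT.1 (μ.toSOT_mem_closure_elemVal hE hμ hφ hT) hx hx'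
  rw [← Set.range_comp] at hlub
  have hmono : Monotone fun n => x'.toLin ((μ.elemVal (φ n)).toLin x) := fun m n hmn =>
    RegularOp.functional_mono hx' (μ.elemVal_mono hE hμ (hφ hmn) x hx)
  rw [μ.lintegral_weak_eq_iSup hE hμ hφ hf hx hx']
  refine tendsto_nhds_unique (tendsto_atTop_iSup fun m n hmn =>
    ENNReal.ofReal_le_ofReal (hmono hmn)) ?_
  exact (ENNReal.continuous_ofReal.tendsto _).comp (tendsto_atTop_isLUB hmono hlub)

lemma HasOrderIntegral.nonneg {f : X → ℝ≥0∞} {T : RegularOp E E} (hμ : μ.IsFinite)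
    (h : μ.HasOrderIntegral f (T : WithTop _)) : 0 ≤ T := by
  obtain ⟨φ, -, -, hT⟩ := h
  rw [μ.range_elemIntegral hμ, isLUB_image_coe] at hT
  exact (μ.elemVal_nonneg (φ 0)).trans (hT.1 ⟨0, rfl⟩)

include hE hμ in
-- If the elementary integrals are order bounded, their strong limit is the supremum. Otherwise `⊤`
-- is their only upper bound in the extended order.
lemma exists_hasOrderIntegral {f : X → ℝ≥0∞} (hf : Measurable f) :
    ∃ y, μ.HasOrderIntegral f y := by
  let φ : ℕ → SimpleFunc X ℝ≥0 := fun n => (SimpleFunc.eapprox f n).map ENNReal.toNNReal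
  have hφa : ∀ n a, ((φ n a : ℝ≥0) : ℝ≥0∞) = SimpleFunc.eapprox f n a := fun n a =>
    ENNReal.coe_toNNReal (SimpleFunc.eapprox_lt_top f n a).ne
  have hφ : Monotone φ := fun m n hmn a => by
    rw [← ENNReal.coe_le_coe, hφa, hφa]
    exact SimpleFunc.monotone_eapprox f hmn a
  have hsup : ∀ a, ⨆ n, (φ n a : ℝ≥0∞) = f a := fun a => by
    simp_rw [hφa]
    exact SimpleFunc.iSup_eapprox_apply hf a
  by_cases hb : BddAbove (Set.range fun n => μ.elemVal (φ n))
  · obtain ⟨B, hB⟩ := hb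
    obtain ⟨T, hT, hTc⟩ := RegularOp.exists_upperBound_mem_closure hE
      (Set.range_nonempty fun n => μ.elemVal (φ n))
      (Monotone.directed_le ((μ.elemVal_mono hE hμ).comp hφ)).directedOn_range
      (by rintro _ ⟨n, rfl⟩; exact μ.elemVal_nonneg _)
      (fun x hx => ⟨‖B.toLin x‖, fun R hR => by
        obtain ⟨n, rfl⟩ := hR
        exact norm_le_norm_of_nonneg_of_le (μ.elemVal_nonneg _ x hx) (hB ⟨n, rfl⟩ x hx)⟩)
    refine ⟨T, φ, hφ, hsup, ?_⟩
    rw [μ.range_elemIntegral hμ, isLUB_image_coe]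
    exact RegularOp.isLUB_of_mem_closure hT hTc
  · refine ⟨⊤, φ, hφ, hsup, fun _ _ => le_top, fun z hz => ?_⟩
    induction z using WithTop.recTopCoe with
    | top => exact le_rfl
    | coe z =>
      rw [μ.range_elemIntegral hμ] at hz
      exact absurd ⟨z, fun y hy => WithTop.coe_le_coe.1 (hz ⟨y, hy, rfl⟩)⟩ hb

include hE hμ in
lemma hasOrderIntegral_lintegral {f : X → ℝ≥0∞} (hf : Measurable f) :
    μ.HasOrderIntegral f (μ.lintegral f) := by
  have h := μ.exists_hasOrderIntegral hE hμ hf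
  rw [lintegral, dif_pos h]
  exact h.choose_spec

include hE hμ in
lemma hasOrderIntegral_untopD {f : X → ℝ≥0∞} (hf : Measurable f) (h : μ.lintegral f ≠ ⊤) :
    μ.HasOrderIntegral f (((μ.lintegral f).untopD 0 : RegularOp E E) : WithTop _) := by
  have h2 := μ.hasOrderIntegral_lintegral hE hμ hf
  generalize μ.lintegral f = y at h h2 ⊢
  induction y using WithTop.recTopCoe with
  | top => exact absurd rfl h
  | coe y => exact h2

/-- Finiteness can be tested weakly, provided that one operator `S` bounds all pairings: `S` then
dominates every elementary integral. -/
lemma lintegral_ne_top {f : X → ℝ≥0∞} (hf : Measurable f) {S : RegularOp E E} (hS : 0 ≤ S)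
    (h : ∀ (x : E) (x' : RegularOp E ℝ), 0 ≤ x → 0 ≤ x' →
      ∫⁻ a, f a ∂(μ.weak hE hμ x x') ≤ ENNReal.ofReal (x'.toLin (S.toLin x))) :
    μ.lintegral f ≠ ⊤ := by
  obtain ⟨φ, hφ, hsup, hlub⟩ := μ.hasOrderIntegral_lintegral hE hμ hf
  refine ne_top_of_le_ne_top (WithTop.coe_ne_top (a := S)) (hlub.2 ?_)
  rintro _ ⟨n, rfl⟩
  simp only [μ.elemIntegral_eq hμ]
  rw [WithTop.coe_le_coe]
  refine RegularOp.le_of_forall fun x x' hx hx' => ?_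
  rw [← ENNReal.ofReal_le_ofReal_iff (RegularOp.functional_nonneg hx'
    (RegularOp.apply_nonneg hS hx))]
  refine le_trans ?_ (h x x' hx hx')
  rw [μ.lintegral_weak_eq_iSup hE hμ hφ hsup hx hx']
  exact le_iSup (fun n => ENNReal.ofReal (x'.toLin ((μ.elemVal (φ n)).toLin x))) n

lemma mem_L1_of_le {f : X → ℝ} (hf : Measurable f) {S : RegularOp E E} (hS : 0 ≤ S)
    (h : ∀ (x : E) (x' : RegularOp E ℝ), 0 ≤ x → 0 ≤ x' →
      ∫⁻ a, ENNReal.ofReal |f a| ∂(μ.weak hE hμ x x')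
        ≤ ENNReal.ofReal (x'.toLin (S.toLin x))) : f ∈ μ.L1 :=
  ⟨hf, μ.lintegral_ne_top hE hμ hf.abs.ennreal_ofReal hS h⟩

include hE hμ in
lemma mem_L1_of_bounded {f : X → ℝ} (hf : Measurable f) {M : ℝ} (hM : ∀ a, |f a| ≤ M) :
    f ∈ μ.L1 := by
  -- The maximum with `0` covers the empty space, where `M` may be negative.
  have hS : 0 ≤ (max M 0) • μ.val Set.univ := fun x hx =>
    smul_nonneg (le_max_right M 0) (μ.val_nonneg _ x hx)
  refine μ.mem_L1_of_le hE hμ hf hS fun x x' hx hx' => ?_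
  calc ∫⁻ a, ENNReal.ofReal |f a| ∂(μ.weak hE hμ x x')
      ≤ ∫⁻ _, ENNReal.ofReal (max M 0) ∂(μ.weak hE hμ x x') :=
        lintegral_mono fun a => ENNReal.ofReal_le_ofReal ((hM a).trans (le_max_left M 0))
    _ = _ := by
      rw [lintegral_const, μ.weak_apply hE hμ hx hx' MeasurableSet.univ,
        ← ENNReal.ofReal_mul (le_max_right M 0)]
      simp

variable {μ}

include hE hμ in
lemma lintegral_le_ne_top_of_mem_L1 {f : X → ℝ} (hf : f ∈ μ.L1) {g : X → ℝ}
    (hg : Measurable g) (hgf : ∀ a, g a ≤ |f a|) :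
    μ.lintegral (fun a => ENNReal.ofReal (g a)) ≠ ⊤ := by
  have h := μ.hasOrderIntegral_untopD hE hμ hf.1.abs.ennreal_ofReal hf.2
  refine μ.lintegral_ne_top hE hμ hg.ennreal_ofReal (h.nonneg μ hμ) fun x x' hx hx' => ?_
  rw [← h.lintegral_weak μ hE hμ hx hx']
  exact lintegral_mono fun a => ENNReal.ofReal_le_ofReal (hgf a)

/-- An integrable function is integrable with respect to all positive measures `μ_{x,x'}`. -/
lemma integrable_weak {f : X → ℝ} (hf : f ∈ μ.L1) {x : E} {x' : RegularOp E ℝ} (hx : 0 ≤ x)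
    (hx' : 0 ≤ x') : Integrable f (μ.weak hE hμ x x') := by
  refine ⟨hf.1.aestronglyMeasurable, ?_⟩
  rw [hasFiniteIntegral_iff_norm]
  have h := μ.hasOrderIntegral_untopD hE hμ hf.1.abs.ennreal_ofReal hf.2
  have := h.lintegral_weak μ hE hμ hx hx'
  simp only [Real.norm_eq_abs]
  rw [this]
  exact ENNReal.ofReal_lt_top

/-- The weak description of the order integral. -/
lemma functional_integral {f : X → ℝ} (hf : f ∈ μ.L1) {x : E} {x' : RegularOp E ℝ} (hx : 0 ≤ x)
    (hx' : 0 ≤ x') :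
    x'.toLin ((μ.integral f).toLin x) = ∫ a, f a ∂(μ.weak hE hμ x x') := by
  have h1 := μ.hasOrderIntegral_untopD hE hμ hf.1.ennreal_ofReal
    (lintegral_le_ne_top_of_mem_L1 hE hμ hf hf.1 fun a => le_abs_self (f a))
  have h2 := μ.hasOrderIntegral_untopD hE hμ hf.1.neg.ennreal_ofReal
    (lintegral_le_ne_top_of_mem_L1 hE hμ hf hf.1.neg fun a => neg_le_abs (f a))
  rw [integral_eq_lintegral_pos_part_sub_lintegral_neg_part (integrable_weak hE hμ hf hx hx'),
    h1.lintegral_weak μ hE hμ hx hx']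
  have h3 := h2.lintegral_weak μ hE hμ hx hx'
  simp only [Pi.neg_apply] at h3
  rw [h3, ENNReal.toReal_ofReal, ENNReal.toReal_ofReal, integral]
  · simp
  · exact RegularOp.functional_nonneg hx' (h2.nonneg μ hμ x hx)
  · exact RegularOp.functional_nonneg hx' (h1.nonneg μ hμ x hx)

include hE hμ in
lemma integral_unique {f : X → ℝ} (hf : f ∈ μ.L1) {T : RegularOp E E}
    (h : ∀ (x : E) (x' : RegularOp E ℝ), 0 ≤ x → 0 ≤ x' →
      x'.toLin (T.toLin x) = ∫ a, f a ∂(μ.weak hE hμ x x')) : T = μ.integral f :=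
  RegularOp.eq_of_forall fun x x' hx hx' => by
    rw [h x x' hx hx', functional_integral hE hμ hf hx hx']

end PosMeasure

/-! ### Closed subspaces for the strong operator topology -/

lemma toSOT_mem_sotSpan {E : Type*} [NormedAddCommGroup E] [Lattice E] [IsOrderedAddMonoid E]
    [HasSolidNorm E] [NormedSpace ℝ E] [PosSMulMono ℝ E] [CompleteSpace E]
    {S : Set (RegularOp E E)} {T : RegularOp E E} (hT : T ∈ S) : T.toSOT ∈ sotSpan S :=
  Submodule.le_topologicalClosure _ (Submodule.subset_span ⟨T, hT, rfl⟩)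

lemma sotSpan_le {E : Type*} [NormedAddCommGroup E] [Lattice E] [IsOrderedAddMonoid E]
    [HasSolidNorm E] [NormedSpace ℝ E] [PosSMulMono ℝ E] [CompleteSpace E]
    {S : Set (RegularOp E E)} {L : Submodule ℝ (E →Lₚₜ[ℝ] E)}
    (hL : IsClosed (L : Set (E →Lₚₜ[ℝ] E))) (h : ∀ T ∈ S, T.toSOT ∈ L) : sotSpan S ≤ L := by
  refine Submodule.topologicalClosure_minimal _ (Submodule.span_le.2 ?_) hL
  rintro _ ⟨T, hT, rfl⟩
  exact h T hT

namespace PosMeasure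

variable {X : Type*} [MeasurableSpace X]
  {E : Type*} [NormedAddCommGroup E] [Lattice E] [IsOrderedAddMonoid E] [HasSolidNorm E]
  [NormedSpace ℝ E] [PosSMulMono ℝ E] [CompleteSpace E]
  {μ : PosMeasure X (RegularOp E E)} (hE : IsKBSpace E) (hμ : μ.IsFinite)

include hE hμ in
-- Elementary integrals are linear combinations of values of `μ`, and the order integrals of `f⁺`
-- and `f⁻` are strong limits of these.
lemma toSOT_integral_mem {L : Submodule ℝ (E →Lₚₜ[ℝ] E)}
    (hL : IsClosed (L : Set (E →Lₚₜ[ℝ] E)))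
    (h : ∀ A, MeasurableSet A → (μ.val A).toSOT ∈ L) {f : X → ℝ} (hf : f ∈ μ.L1) :
    (μ.integral f).toSOT ∈ L := by
  have elem : ∀ φ : SimpleFunc X ℝ≥0, (μ.elemVal φ).toSOT ∈ L := by
    intro φ
    have : (μ.elemVal φ).toSOT = ∑ r ∈ φ.range, (r : ℝ) • (μ.val (φ ⁻¹' {r})).toSOT := by
      ext x
      simp only [RegularOp.toSOT_apply, elemVal, toLin_sum]
      rw [sum_apply]
      rfl
    rw [this]
    exact L.sum_mem fun r _ => L.smul_mem _ (h _ (φ.measurableSet_preimage _))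
  have key : ∀ {g : X → ℝ≥0∞} {T : RegularOp E E},
      μ.HasOrderIntegral g (T : WithTop _) → T.toSOT ∈ L := by
    rintro g T ⟨φ, hφ, -, hT⟩
    rw [μ.range_elemIntegral hμ, isLUB_image_coe] at hT
    refine hL.closure_subset_iff.2 ?_ (μ.toSOT_mem_closure_elemVal hE hμ hφ hT)
    rintro _ ⟨_, ⟨n, rfl⟩, rfl⟩
    exact elem _
  rw [integral, RegularOp.toSOT_sub]
  exact L.sub_mem
    (key (μ.hasOrderIntegral_untopD hE hμ hf.1.ennreal_ofReal
      (lintegral_le_ne_top_of_mem_L1 hE hμ hf hf.1 fun a => le_abs_self (f a))))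
    (key (μ.hasOrderIntegral_untopD hE hμ hf.1.neg.ennreal_ofReal
      (lintegral_le_ne_top_of_mem_L1 hE hμ hf hf.1.neg fun a => neg_le_abs (f a))))

end PosMeasure

/-! ### Scalar regular measures and Urysohn functions -/

section RegularMeasures

variable {X : Type*} [TopologicalSpace X] [MeasurableSpace X] [BorelSpace X]

/-- Finiteness of `ρ` allows approximating sets whose difference from the given set is `ρ`-small,
hence `m`-small. Such differences, unlike values of the measure, compare under `m ≤ ρ`. -/
lemma regular_of_le [T2Space X] {m ρ : Measure X} [IsFiniteMeasure ρ] [ρ.Regular] (h : m ≤ ρ) :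
    m.Regular where
  lt_top_of_isCompact K _ := (h K).trans_lt (measure_lt_top ρ K)
  outerRegular A hA r hr := by
    obtain ⟨U, hAU, hU, -, hUA⟩ := hA.exists_isOpen_sdiff_lt (μ := ρ) (measure_ne_top ρ A)
      (ε := r - m A) (tsub_pos_of_lt hr).ne'
    refine ⟨U, hAU, hU, ?_⟩
    have hfin : m A ≠ ⊤ := hr.ne_top
    calc m U = m A + m (U \ A) := by
            rw [measure_sdiff hAU hA.nullMeasurableSet hfin, add_tsub_cancel_of_le (measure_mono hAU)]
      _ < m A + (r - m A) := ENNReal.add_lt_add_left hfin ((h _).trans_lt hUA)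
      _ = r := add_tsub_cancel_of_le hr.le
  innerRegular U hU r hr := by
    obtain ⟨K, hKU, hK, hUK⟩ := hU.measurableSet.exists_isCompact_sdiff_lt (μ := ρ)
      (measure_ne_top ρ U) (ε := m U - r) (tsub_pos_of_lt hr).ne'
    refine ⟨K, hKU, hK, ?_⟩
    by_contra! hle
    have : m U < m U := calc
      m U ≤ m K + m (U \ K) := by
        rw [← measure_union Set.disjoint_sdiff_right (hU.measurableSet.diff hK.measurableSet)]
        exact measure_mono (by rw [Set.union_sdiff_self]; exact Set.subset_union_right)
      _ ≤ r + m (U \ K) := by gcongr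
      _ < r + (m U - r) := ENNReal.add_lt_add_left hr.ne_top ((h _).trans_lt hUK)
      _ = m U := add_tsub_cancel_of_le hr.le
    exact lt_irrefl _ this

variable {m : Measure X} [IsFiniteMeasure m] [m.Regular]

lemma real_le_add_of_lt {m : Measure X} [IsFiniteMeasure m] {A B : Set X} {ε : ℝ} (hε : 0 < ε)
    (h : m A < m B + ENNReal.ofReal ε) : m.real A ≤ m.real B + ε := by
  have := ENNReal.toReal_mono (ENNReal.add_ne_top.2 ⟨measure_ne_top m B, ENNReal.ofReal_ne_top⟩)
    h.le
  rwa [ENNReal.toReal_add (measure_ne_top m B) ENNReal.ofReal_ne_top,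
    ENNReal.toReal_ofReal hε.le] at this

lemma isLUB_real_isCompact {V : Set X} (hV : IsOpen V) :
    IsLUB {r | ∃ K, IsCompact K ∧ K ⊆ V ∧ r = m.real K} (m.real V) := by
  refine ⟨?_, fun b hb => le_of_forall_pos_le_add fun ε hε => ?_⟩
  · rintro _ ⟨K, -, hKV, rfl⟩
    exact measureReal_mono hKV
  · obtain ⟨K, hKV, hK, h⟩ := hV.measurableSet.exists_isCompact_lt_add (measure_ne_top m V)
      (ENNReal.ofReal_pos.2 hε).ne'
    exact (real_le_add_of_lt hε h).trans (add_le_add_left (hb ⟨K, hK, hKV, rfl⟩) ε)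

lemma isGLB_real_isOpen (A : Set X) :
    IsGLB {r | ∃ V, IsOpen V ∧ A ⊆ V ∧ r = m.real V} (m.real A) := by
  refine ⟨?_, fun b hb => le_of_forall_pos_le_add fun ε hε => ?_⟩
  · rintro _ ⟨V, -, hAV, rfl⟩
    exact measureReal_mono hAV
  · obtain ⟨V, hAV, hV, h⟩ := A.exists_isOpen_lt_add (measure_ne_top m A)
      (ENNReal.ofReal_pos.2 hε).ne'
    exact (hb ⟨V, hV, hAV, rfl⟩).trans (real_le_add_of_lt hε h)

lemma exists_setPrecedes_precedesSet [T2Space X] [LocallyCompactSpace X] {K V : Set X}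
    (hK : IsCompact K) (hV : IsOpen V) (hKV : K ⊆ V) :
    ∃ f : C₀(X, ℝ), SetPrecedes K f ∧ PrecedesSet f V := by
  obtain ⟨f, h1, hf, hfV, h01⟩ := exists_continuousMap_one_of_isCompact_subset_isOpen hK hV hKV
  let g : C₀(X, ℝ) := ⟨f, HasCompactSupport.is_zero_at_infty hf⟩
  exact ⟨g, ⟨hf, h01, h1⟩, hf, h01, hfV⟩

omit [m.Regular] in
lemma integrable_zeroAtInfty (f : C₀(X, ℝ)) : Integrable f m := by
  refine Integrable.of_bound (C := ‖f.toBCF‖) f.continuous.measurable.aestronglyMeasurable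
    (Eventually.of_forall fun x => f.toBCF.norm_coe_le_norm x)

omit [m.Regular] in
lemma integral_le_of_precedesSet {f : C₀(X, ℝ)} {V : Set X} (hV : MeasurableSet V)
    (hf : PrecedesSet f V) : ∫ x, f x ∂m ≤ m.real V := by
  rw [← integral_indicator_one hV]
  refine integral_mono (integrable_zeroAtInfty f) ((integrable_const 1).indicator hV) fun x => ?_
  by_cases hx : x ∈ V
  · simpa [hx] using (hf.2.1 x).2
  · have : f x = 0 := image_eq_zero_of_notMem_tsupport fun h => hx (hf.2.2 h)
    simp [hx, this]

omit [m.Regular] in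
lemma le_integral_of_setPrecedes {f : C₀(X, ℝ)} {K : Set X} (hK : MeasurableSet K)
    (hf : SetPrecedes K f) : m.real K ≤ ∫ x, f x ∂m := by
  rw [← integral_indicator_one hK]
  refine integral_mono ((integrable_const 1).indicator hK) (integrable_zeroAtInfty f) fun x => ?_
  by_cases hx : x ∈ K
  · simp [hx, hf.2.2 x hx]
  · simpa [hx] using (hf.2.1 x).1

/-- A Urysohn function with `K ≺ f ≺ V` squeezes its integral between the measures of `K` and `V`,
so inner regularity concludes. -/
lemma isLUB_integral_precedesSet [T2Space X] [LocallyCompactSpace X] {V : Set X}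
    (hV : IsOpen V) :
    IsLUB {r | ∃ f : C₀(X, ℝ), PrecedesSet f V ∧ r = ∫ x, f x ∂m} (m.real V) := by
  refine ⟨?_, fun b hb => (isLUB_real_isCompact hV).2 ?_⟩
  · rintro _ ⟨f, hf, rfl⟩
    exact integral_le_of_precedesSet hV.measurableSet hf
  · rintro _ ⟨K, hK, hKV, rfl⟩
    obtain ⟨f, hKf, hfV⟩ := exists_setPrecedes_precedesSet hK hV hKV
    exact (le_integral_of_setPrecedes hK.measurableSet hKf).trans (hb ⟨f, hfV, rfl⟩)

lemma isGLB_integral_setPrecedes [T2Space X] [LocallyCompactSpace X] {K : Set X}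
    (hK : IsCompact K) :
    IsGLB {r | ∃ f : C₀(X, ℝ), SetPrecedes K f ∧ r = ∫ x, f x ∂m} (m.real K) := by
  refine ⟨?_, fun b hb => (isGLB_real_isOpen K).2 ?_⟩
  · rintro _ ⟨f, hf, rfl⟩
    exact le_integral_of_setPrecedes hK.measurableSet hf
  · rintro _ ⟨V, hV, hKV, rfl⟩
    obtain ⟨f, hKf, hfV⟩ := exists_setPrecedes_precedesSet hK hV hKV
    exact (hb ⟨f, hKf, rfl⟩).trans (integral_le_of_precedesSet hV.measurableSet hfV)

end RegularMeasures

/-! ### Regularity passes to the scalar measures -/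

namespace PosMeasure

variable {X : Type*} [TopologicalSpace X] [T2Space X] [MeasurableSpace X] [BorelSpace X]
  {E : Type*} [NormedAddCommGroup E] [Lattice E] [IsOrderedAddMonoid E] [HasSolidNorm E]
  [NormedSpace ℝ E] [PosSMulMono ℝ E] [CompleteSpace E]
  {μ : PosMeasure X (RegularOp E E)} (hE : IsKBSpace E) (hμ : μ.IsFinite)

section Regular

variable (hr : μ.IsRegularBorel)

include hμ hr

lemma IsRegularBorel.isLUB_val {V : Set X} (hV : IsOpen V) :
    IsLUB {T | ∃ K, IsCompact K ∧ K ⊆ V ∧ T = μ.val K} (μ.val V) := by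
  rw [← isLUB_image_coe, μ.coe_val (μ.ne_top hμ V)]
  convert hr.innerRegular V hV using 1
  ext y
  constructor
  · rintro ⟨_, ⟨K, hK, hKV, rfl⟩, rfl⟩
    exact ⟨K, hK, hKV, μ.coe_val (μ.ne_top hμ K)⟩
  · rintro ⟨K, hK, hKV, rfl⟩
    exact ⟨_, ⟨K, hK, hKV, rfl⟩, μ.coe_val (μ.ne_top hμ K)⟩

lemma IsRegularBorel.isGLB_val {A : Set X} (hA : MeasurableSet A) :
    IsGLB {T | ∃ V, IsOpen V ∧ A ⊆ V ∧ T = μ.val V} (μ.val A) := by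
  have hne : {T | ∃ V, IsOpen V ∧ A ⊆ V ∧ T = μ.val V}.Nonempty :=
    ⟨_, Set.univ, isOpen_univ, Set.subset_univ A, rfl⟩
  rw [← isGLB_image_coe hne, μ.coe_val (μ.ne_top hμ A)]
  convert hr.outerRegular A hA using 1
  ext y
  constructor
  · rintro ⟨_, ⟨V, hV, hAV, rfl⟩, rfl⟩
    exact ⟨V, hV, hAV, μ.coe_val (μ.ne_top hμ V)⟩
  · rintro ⟨V, hV, hAV, rfl⟩
    exact ⟨_, ⟨V, hV, hAV, rfl⟩, μ.coe_val (μ.ne_top hμ V)⟩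

include hE

lemma IsRegularBorel.mem_closure_isCompact {V : Set X} (hV : IsOpen V) :
    (μ.val V).toSOT ∈
      closure (RegularOp.toSOT '' {T | ∃ K, IsCompact K ∧ K ⊆ V ∧ T = μ.val K}) := by
  refine RegularOp.mem_closure_of_isLUB hE ?_ ?_ ?_ (hr.isLUB_val hμ hV)
  · exact ⟨_, ∅, isCompact_empty, Set.empty_subset V, rfl⟩
  · rintro _ ⟨K, hK, hKV, rfl⟩ _ ⟨L, hL, hLV, rfl⟩
    have hKL := hK.union hL
    exact ⟨_, ⟨K ∪ L, hKL, Set.union_subset hKV hLV, rfl⟩,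
      μ.val_mono hμ hK.measurableSet hKL.measurableSet Set.subset_union_left,
      μ.val_mono hμ hL.measurableSet hKL.measurableSet Set.subset_union_right⟩
  · rintro _ ⟨K, -, -, rfl⟩
    exact μ.val_nonneg K

lemma IsRegularBorel.mem_closure_isOpen {A : Set X} (hA : MeasurableSet A) :
    (μ.val A).toSOT ∈
      closure (RegularOp.toSOT '' {T | ∃ V, IsOpen V ∧ A ⊆ V ∧ T = μ.val V}) := by
  refine RegularOp.mem_closure_of_isGLB hE ?_ ?_ ?_ (hr.isGLB_val hμ hA)
  · exact ⟨_, Set.univ, isOpen_univ, Set.subset_univ A, rfl⟩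
  · rintro _ ⟨V, hV, hAV, rfl⟩ _ ⟨W, hW, hAW, rfl⟩
    have hVW := hV.inter hW
    exact ⟨_, ⟨V ∩ W, hVW, Set.subset_inter hAV hAW, rfl⟩,
      μ.val_mono hμ hVW.measurableSet hV.measurableSet Set.inter_subset_left,
      μ.val_mono hμ hVW.measurableSet hW.measurableSet Set.inter_subset_right⟩
  · rintro _ ⟨V, -, -, rfl⟩
    exact μ.val_nonneg V

/-- Unions of compact sets and intersections of open sets make the families in the regularity
conditions directed. Their suprema and infima are then strong limits and survive the pairing. -/
lemma IsRegularBorel.regular_weak {x : E} {x' : RegularOp E ℝ} (hx : 0 ≤ x) (hx' : 0 ≤ x') :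
    (μ.weak hE hμ x x').Regular where
  lt_top_of_isCompact K _ := measure_lt_top _ K
  outerRegular A hA r h := by
    rcases eq_or_ne r ⊤ with rfl | hrt
    · exact ⟨Set.univ, Set.subset_univ A, isOpen_univ, measure_lt_top _ _⟩
    have hglb := RegularOp.isGLB_weak (hr.isGLB_val hμ hA).1
      (hr.mem_closure_isOpen hE hμ hA) hx hx'
    rw [μ.weak_apply hE hμ hx hx' hA, gt_iff_lt, ENNReal.ofReal_lt_iff_lt_toReal
      (RegularOp.functional_nonneg hx' (μ.val_nonneg A x hx)) hrt] at h
    obtain ⟨_, ⟨_, ⟨V, hV, hAV, rfl⟩, rfl⟩, -, hlt⟩ := hglb.exists_between h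
    refine ⟨V, hAV, hV, ?_⟩
    rwa [μ.weak_apply hE hμ hx hx' hV.measurableSet, ENNReal.ofReal_lt_iff_lt_toReal
      (RegularOp.functional_nonneg hx' (μ.val_nonneg V x hx)) hrt]
  innerRegular V hV r h := by
    have hrt := h.ne_top
    have hlub := RegularOp.isLUB_weak (hr.isLUB_val hμ hV).1
      (hr.mem_closure_isCompact hE hμ hV) hx hx'
    rw [μ.weak_apply hE hμ hx hx' hV.measurableSet,
      ENNReal.lt_ofReal_iff_toReal_lt hrt] at h
    obtain ⟨_, ⟨_, ⟨K, hK, hKV, rfl⟩, rfl⟩, hlt, -⟩ := hlub.exists_between h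
    refine ⟨K, hKV, hK, ?_⟩
    rwa [μ.weak_apply hE hμ hx hx' hK.measurableSet, ENNReal.lt_ofReal_iff_toReal_lt hrt]

end Regular

end PosMeasure

/-! ### Signed measures for arbitrary vectors and functionals -/

lemma RegularOp.exists_eq_sub {E : Type*} [AddCommGroup E] [Lattice E] [IsOrderedAddMonoid E]
    [Module ℝ E] (x' : RegularOp E ℝ) :
    ∃ P Q : RegularOp E ℝ, 0 ≤ P ∧ 0 ≤ Q ∧ x' = P - Q := by
  obtain ⟨P, Q, hP, hQ, h⟩ := x'.2
  exact ⟨⟨P, P, 0, hP, fun _ _ => le_rfl, (sub_zero P).symm⟩,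
    ⟨Q, Q, 0, hQ, fun _ _ => le_rfl, (sub_zero Q).symm⟩, hP, hQ, Subtype.ext h⟩

lemma RegularOp.abs_apply_le {E : Type*} [NormedAddCommGroup E] [Lattice E]
    [IsOrderedAddMonoid E] [HasSolidNorm E] [NormedSpace ℝ E] [PosSMulMono ℝ E]
    {P Q : RegularOp E ℝ} (hP : 0 ≤ P) (hQ : 0 ≤ Q) {T : RegularOp E E} (hT : 0 ≤ T) (x : E) :
    |(P - Q).toLin (T.toLin x)| ≤ (P + Q).toLin (T.toLin |x|) := by
  have h1 : T.toLin x ≤ T.toLin |x| := by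
    have : 0 ≤ T.toLin (|x| - x) := hT (|x| - x) (sub_nonneg.2 (le_abs_self x))
    rw [map_sub] at this
    exact sub_nonneg.1 this
  have h2 : -T.toLin x ≤ T.toLin |x| := by
    have : 0 ≤ T.toLin (|x| - -x) := hT (|x| - -x) (sub_nonneg.2 (neg_le_abs x))
    rw [map_sub, map_neg] at this
    exact sub_nonneg.1 this
  have a1 := functional_mono hP h1
  have a2 := functional_mono hP h2
  have b1 := functional_mono hQ h1
  have b2 := functional_mono hQ h2
  rw [map_neg] at a2 b2
  rw [abs_le, toLin_sub, toLin_add, LinearMap.sub_apply, LinearMap.add_apply]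
  constructor <;> linarith

namespace PosMeasure

variable {X : Type*} [MeasurableSpace X]
  {E : Type*} [NormedAddCommGroup E] [Lattice E] [IsOrderedAddMonoid E] [HasSolidNorm E]
  [NormedSpace ℝ E] [PosSMulMono ℝ E] [CompleteSpace E]
  {μ : PosMeasure X (RegularOp E E)} (hE : IsKBSpace E) (hμ : μ.IsFinite)

/-- The variation is at most any positive measure that bounds the signed measure setwise. This
domination by a positive pair yields both integrability and regularity for arbitrary pairs. -/
lemma variation_signed_le {P Q : RegularOp E ℝ} (hP : 0 ≤ P) (hQ : 0 ≤ Q) (x : E) :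
    (μ.signed hE hμ x (P - Q)).variation ≤ μ.weak hE hμ |x| (P + Q) := by
  refine VectorMeasure.variation_le_of_forall_enorm_le fun A hA => ?_
  rw [μ.weak_apply hE hμ (abs_nonneg x) (add_nonneg hP hQ) hA, ← ofReal_norm]
  exact ENNReal.ofReal_le_ofReal (RegularOp.abs_apply_le hP hQ (μ.val_nonneg A) x)

/-- The weak description of the order integral by the signed measures `μ_{x,x'}`. -/
lemma functional_integral_signed {f : X → ℝ} (hf : f ∈ μ.L1) (x : E) (x' : RegularOp E ℝ) :
    (μ.signed hE hμ x x').Integrable f ∧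
      x'.toLin ((μ.integral f).toLin x) = ∫ᵛ y, f y ∂<•(μ.signed hE hμ x x') := by
  obtain ⟨P, Q, hP, hQ, rfl⟩ := x'.exists_eq_sub
  refine ⟨(integrable_weak hE hμ hf (abs_nonneg x) (add_nonneg hP hQ)).mono_measure
    (variation_signed_le hE hμ hP hQ x), ?_⟩
  have hint : ∀ {z : E} {R : RegularOp E ℝ}, 0 ≤ z → 0 ≤ R →
      (μ.signed hE hμ z R).Integrable f ∧
      R.toLin ((μ.integral f).toLin z) = ∫ᵛ y, f y ∂<•(μ.signed hE hμ z R) := by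
    intro z R hz hR
    refine ⟨integrable_weak hE hμ hf hz hR, ?_⟩
    rw [functional_integral hE hμ hf hz hR, ← μ.toSignedMeasure_weak hE hμ hz hR,
      VectorMeasure.integral_toSignedMeasure]
  have hx := posPart_nonneg x
  have hx' := negPart_nonneg x
  -- Bilinearity in `(x, x')` reduces the formula to four positive pairs.
  have hdec : μ.signed hE hμ x (P - Q) =
      (μ.signed hE hμ x⁺ P - μ.signed hE hμ x⁺ Q)
        - (μ.signed hE hμ x⁻ P - μ.signed hE hμ x⁻ Q) := by
    ext A hA
    simp only [sub_apply, signed_apply, RegularOp.toLin_sub, LinearMap.sub_apply]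
    conv_lhs => rw [← posPart_sub_negPart x]
    simp only [map_sub]
    ring
  have hP1 := hint hx hP
  have hQ1 := hint hx hQ
  have hP2 := hint hx' hP
  have hQ2 := hint hx' hQ
  have hsub : ∀ {z : E}, (μ.signed hE hμ z P).Integrable f → (μ.signed hE hμ z Q).Integrable f →
      (μ.signed hE hμ z P - μ.signed hE hμ z Q).Integrable f := fun h h' =>
    (Integrable.add_measure h h').mono_measure VectorMeasure.variation_sub_le
  rw [hdec, VectorMeasure.integral_sub_vectorMeasure (hsub hP1.1 hQ1.1) (hsub hP2.1 hQ2.1),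
    VectorMeasure.integral_sub_vectorMeasure hP1.1 hQ1.1,
    VectorMeasure.integral_sub_vectorMeasure hP2.1 hQ2.1, ← hP1.2, ← hQ1.2, ← hP2.2, ← hQ2.2]
  conv_lhs => rw [← posPart_sub_negPart x]
  simp only [map_sub, RegularOp.toLin_sub, LinearMap.sub_apply]

lemma integral_signed_of_nonneg (f : X → ℝ) {x : E} {x' : RegularOp E ℝ}
    (hx : 0 ≤ x) (hx' : 0 ≤ x') :
    ∫ᵛ y, f y ∂<•(μ.signed hE hμ x x') = ∫ a, f a ∂(μ.weak hE hμ x x') := by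
  rw [← μ.toSignedMeasure_weak hE hμ hx hx', VectorMeasure.integral_toSignedMeasure]

lemma IsRegularBorel.regular_variation [TopologicalSpace X] [T2Space X] [BorelSpace X]
    (hr : μ.IsRegularBorel) (x : E) (x' : RegularOp E ℝ) :
    (μ.signed hE hμ x x').variation.Regular := by
  obtain ⟨P, Q, hP, hQ, rfl⟩ := x'.exists_eq_sub
  have := hr.regular_weak hE hμ (abs_nonneg x) (add_nonneg hP hQ)
  exact regular_of_le (variation_signed_le hE hμ hP hQ x)

end PosMeasure

/-! ### Positive maps on `C₀(X)`: boundedness and passage from `C_c(X)` -/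

section PositiveMaps

variable {X : Type*} [TopologicalSpace X]

lemma ZeroAtInfty.norm_le_of_forall {f : C₀(X, ℝ)} {M : ℝ} (hM : 0 ≤ M) (h : ∀ x, |f x| ≤ M) :
    ‖f‖ ≤ M := by
  rw [← ZeroAtInftyContinuousMap.norm_toBCF_eq_norm]
  exact (BoundedContinuousFunction.norm_le hM).2 h

lemma ZeroAtInfty.abs_le_norm (f : C₀(X, ℝ)) (x : X) : |f x| ≤ ‖f‖ := by
  rw [← ZeroAtInftyContinuousMap.norm_toBCF_eq_norm]
  exact f.toBCF.norm_coe_le_norm x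

lemma ZeroAtInfty.continuous_eval (x : X) : Continuous fun f : C₀(X, ℝ) => f x := by
  refine (LipschitzWith.of_dist_le_mul (K := 1) fun f g => ?_).continuous
  rw [Real.dist_eq, dist_eq_norm, NNReal.coe_one, one_mul]
  exact ZeroAtInfty.abs_le_norm (f - g) x

/-- Composition with a continuous function that fixes zero. -/
def ZeroAtInfty.compLeft (g : ℝ → ℝ) (hg : Continuous g) (hg0 : g 0 = 0) (f : C₀(X, ℝ)) :
    C₀(X, ℝ) :=
  ⟨⟨g ∘ f, hg.comp f.continuous⟩, by
    have := (hg.tendsto 0).comp f.zero_at_infty'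
    rwa [hg0] at this⟩

lemma exists_bound_of_positive {G : Type*} [NormedAddCommGroup G] [Lattice G]
    [IsOrderedAddMonoid G] [HasSolidNorm G] [NormedSpace ℝ G] {Φ : C₀(X, ℝ) →ₗ[ℝ] G}
    (hΦ : ∀ f : C₀(X, ℝ), (∀ x, 0 ≤ f x) → 0 ≤ Φ f) :
    ∃ C : ℝ, 0 ≤ C ∧ ∀ f : C₀(X, ℝ), (∀ x, 0 ≤ f x) → ‖Φ f‖ ≤ C * ‖f‖ := by
  suffices ∃ C : ℝ, ∀ f : C₀(X, ℝ), (∀ x, 0 ≤ f x) → ‖Φ f‖ ≤ C * ‖f‖ by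
    obtain ⟨C, hC⟩ := this
    exact ⟨max C 0, le_max_right C 0, fun f hf => (hC f hf).trans
      (mul_le_mul_of_nonneg_right (le_max_left C 0) (norm_nonneg f))⟩
  by_contra! h
  -- Rescaled to norm `2⁻ⁿ`, these functions are summable, while their images have norm above `4ⁿ ·
  -- 2⁻ⁿ = 2ⁿ`. The sum dominates every term, so its image would have infinite norm.
  choose f hf0 hf using fun n : ℕ => h (4 ^ n)
  have hpos : ∀ n, 0 < ‖f n‖ := by
    intro n
    rcases (norm_nonneg (f n)).eq_or_lt with h0 | h0
    · have h1 : f n = 0 := norm_eq_zero.1 h0.symm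
      have h2 := hf n
      simp [h1] at h2
    · exact h0
  let c : ℕ → ℝ := fun n => (1 / 2 : ℝ) ^ n * ‖f n‖⁻¹
  have hc : ∀ n, 0 < c n := fun n => by have := hpos n; positivity
  let y : ℕ → C₀(X, ℝ) := fun n => c n • f n
  have hy0 : ∀ n x, 0 ≤ y n x := fun n x => mul_nonneg (hc n).le (hf0 n x)
  have hyn : ∀ n, ‖y n‖ = (1 / 2 : ℝ) ^ n := by
    intro n
    rw [norm_smul, Real.norm_of_nonneg (hc n).le, mul_assoc, inv_mul_cancel₀ (hpos n).ne', mul_one]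
  have hys : Summable y := by
    apply Summable.of_norm
    simp only [hyn]
    exact summable_geometric_of_lt_one (by norm_num) (by norm_num)
  have hle : ∀ n x, y n x ≤ (∑' n, y n) x := by
    intro n x
    have hs : HasSum (fun n => y n x) ((∑' n, y n) x) :=
      hys.hasSum.map (⟨⟨fun f : C₀(X, ℝ) => f x, rfl⟩, fun _ _ => rfl⟩ : C₀(X, ℝ) →+ ℝ)
        (ZeroAtInfty.continuous_eval x)
    exact le_hasSum hs n fun j _ => hy0 j x
  have hbig : ∀ n, (2 : ℝ) ^ n < ‖Φ (y n)‖ := by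
    intro n
    rw [map_smul, norm_smul, Real.norm_of_nonneg (hc n).le]
    calc (2 : ℝ) ^ n = c n * (4 ^ n * ‖f n‖) := by
          rw [mul_mul_mul_comm, inv_mul_cancel₀ (hpos n).ne', ← mul_pow]
          norm_num
      _ < _ := mul_lt_mul_of_pos_left (hf n) (hc n)
  obtain ⟨n, hn⟩ := pow_unbounded_of_one_lt ‖Φ (∑' n, y n)‖ (one_lt_two : (1 : ℝ) < 2)
  refine absurd ((hn.trans (hbig n)).trans_le (norm_le_norm_of_nonneg_of_le (hΦ _ (hy0 n)) ?_))
    (lt_irrefl _)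
  have := hΦ (∑' n, y n - y n) fun x => sub_nonneg.2 (hle n x)
  rwa [map_sub, sub_nonneg] at this

/-- A positive functional on `C₀(X)` that is integration against a finite measure on the functions
with compact support is integration against that measure on all of `C₀(X)`. -/
lemma eq_integral_of_hasCompactSupport [T2Space X] [MeasurableSpace X] [BorelSpace X] {m : Measure X}
    [IsFiniteMeasure m] {Φ : C₀(X, ℝ) →ₗ[ℝ] ℝ}
    (hΦ : ∀ f : C₀(X, ℝ), (∀ x, 0 ≤ f x) → 0 ≤ Φ f)
    (h : ∀ f : C₀(X, ℝ), HasCompactSupport f → Φ f = ∫ x, f x ∂m) (f : C₀(X, ℝ)) :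
    Φ f = ∫ x, f x ∂m := by
  obtain ⟨C, hC0, hC⟩ := exists_bound_of_positive hΦ
  have hC' : ∀ g : C₀(X, ℝ), |Φ g| ≤ C * ‖g‖ := by
    intro g
    let a : C₀(X, ℝ) := ZeroAtInfty.compLeft (fun t => |t|) continuous_abs abs_zero g
    have h1 : 0 ≤ Φ (a - g) := hΦ _ fun x => sub_nonneg.2 (le_abs_self (g x))
    have h2 : 0 ≤ Φ (a + g) := hΦ _ fun x => by
      have := neg_abs_le (g x)
      change 0 ≤ |g x| + g x
      linarith
    have h3 := hC a fun x => abs_nonneg (g x)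
    have h4 : ‖a‖ ≤ ‖g‖ := ZeroAtInfty.norm_le_of_forall (norm_nonneg g) fun x => by
      change |(|g x|)| ≤ _
      rw [abs_abs]
      exact ZeroAtInfty.abs_le_norm g x
    rw [map_sub] at h1
    rw [map_add] at h2
    have h5 : Φ a ≤ C * ‖g‖ :=
      (le_abs_self _).trans (h3.trans (mul_le_mul_of_nonneg_left h4 hC0))
    rw [abs_le]
    constructor <;> linarith
  refine eq_of_abs_sub_le_all fun ε hε => ?_
  obtain ⟨δ, hδ, hδε⟩ : ∃ δ > 0, (C + m.real Set.univ) * δ ≤ ε := by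
    have hK : 0 ≤ C + m.real Set.univ := add_nonneg hC0 measureReal_nonneg
    refine ⟨ε / (C + m.real Set.univ + 1), by positivity, ?_⟩
    rw [mul_div_assoc', div_le_iff₀ (by positivity)]
    nlinarith
  -- Truncation of `f` at `±δ`: `r` is uniformly small, and `f - r` vanishes where `|f| < δ`, so it
  -- has compact support.
  let r : C₀(X, ℝ) := ZeroAtInfty.compLeft (fun t => max (-δ) (min t δ))
    (by fun_prop) (by simp [hδ.le]) f
  have hr : ‖r‖ ≤ δ := ZeroAtInfty.norm_le_of_forall hδ.le fun x => by
    rw [abs_le]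
    exact ⟨le_max_left _ _, max_le (by linarith) (min_le_right _ _)⟩
  have hfr : HasCompactSupport (f - r) := by
    obtain ⟨K, hK, hKf⟩ := mem_cocompact.1
      (f.zero_at_infty'.eventually (Metric.ball_mem_nhds (0 : ℝ) hδ))
    refine HasCompactSupport.intro' hK.closure isClosed_closure fun x hx => ?_
    have hx' : |f x| < δ := by
      simpa using hKf fun hxK => hx (subset_closure hxK)
    rw [abs_lt] at hx'
    change f x - max (-δ) (min (f x) δ) = 0
    rw [min_eq_left hx'.2.le, max_eq_right hx'.1.le, sub_self]
  have key : Φ f - ∫ x, f x ∂m = Φ r - ∫ x, r x ∂m := by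
    have h1 := h (f - r) hfr
    have h2 : ∫ x, (f - r) x ∂m = ∫ x, f x ∂m - ∫ x, r x ∂m :=
      integral_sub (integrable_zeroAtInfty f) (integrable_zeroAtInfty r)
    rw [h2, map_sub] at h1
    linarith
  rw [key]
  have h1 : |∫ x, r x ∂m| ≤ δ * m.real Set.univ :=
    norm_integral_le_of_norm_le_const (μ := m) (f := fun x => r x) (C := δ) (Eventually.of_forall fun x =>
      (ZeroAtInfty.abs_le_norm r x).trans hr)
  calc |Φ r - ∫ x, r x ∂m| ≤ |Φ r| + |∫ x, r x ∂m| := abs_sub _ _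
    _ ≤ C * δ + δ * m.real Set.univ :=
      add_le_add ((hC' r).trans (mul_le_mul_of_nonneg_left hr hC0)) h1
    _ = (C + m.real Set.univ) * δ := by ring
    _ ≤ ε := hδε

end PositiveMaps

/-! ### Construction of the measure -/

section Construction

variable {X : Type*} [TopologicalSpace X] [LocallyCompactSpace X] [T2Space X]
  [MeasurableSpace X] [BorelSpace X]
  {E : Type*} [NormedAddCommGroup E] [Lattice E] [IsOrderedAddMonoid E] [HasSolidNorm E]
  [NormedSpace ℝ E] [PosSMulMono ℝ E] [CompleteSpace E]

section Precedes

omit [LocallyCompactSpace X] [T2Space X] [MeasurableSpace X] [BorelSpace X]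

lemma precedesSet_zero (V : Set X) : PrecedesSet (0 : C₀(X, ℝ)) V := by
  refine ⟨HasCompactSupport.zero, fun x => ⟨le_rfl, zero_le_one⟩, ?_⟩
  have : ((0 : C₀(X, ℝ)) : X → ℝ) = 0 := rfl
  rw [this, tsupport_zero]
  exact Set.empty_subset V

/-- The function `f + g - fg = 1 - (1 - f)(1 - g)` lies above `f` and `g`, stays below `1`, and is
supported in the union of the supports. -/
lemma PrecedesSet.exists_ge {f g : C₀(X, ℝ)} {V : Set X} (hf : PrecedesSet f V)
    (hg : PrecedesSet g V) :
    ∃ h : C₀(X, ℝ), PrecedesSet h V ∧ (∀ x, f x ≤ h x) ∧ ∀ x, g x ≤ h x := by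
  have hh : ∀ x, (f + g - f * g) x = f x + g x - f x * g x := fun x => rfl
  have hsupp : tsupport (f + g - f * g : C₀(X, ℝ)) ⊆ tsupport f ∪ tsupport g := by
    refine closure_minimal (fun x hx => ?_) ((isClosed_tsupport f).union (isClosed_tsupport g))
    by_contra hx'
    rw [Set.mem_union, not_or] at hx'
    refine hx ?_
    rw [hh, image_eq_zero_of_notMem_tsupport hx'.1, image_eq_zero_of_notMem_tsupport hx'.2]
    simp
  refine ⟨f + g - f * g, ⟨?_, fun x => ?_, hsupp.trans (Set.union_subset hf.2.2 hg.2.2)⟩,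
    fun x => ?_, fun x => ?_⟩
  · exact (hf.1.isCompact.union hg.1.isCompact).of_isClosed_subset (isClosed_tsupport _) hsupp
  all_goals
    have h1 := hf.2.1 x
    have h2 := hg.2.1 x
    rw [hh]
  · constructor <;> nlinarith
  · nlinarith
  · nlinarith

end Precedes

variable (hE : IsKBSpace E) {π : C₀(X, ℝ) →ₗ[ℝ] RegularOp E E}
  (hπ : ∀ f : C₀(X, ℝ), (∀ x, 0 ≤ f x) → 0 ≤ π f)

/-- The linear map `f ↦ π(f)x`. -/
noncomputable def applyVec (π : C₀(X, ℝ) →ₗ[ℝ] RegularOp E E) (x : E) : C₀(X, ℝ) →ₗ[ℝ] E where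
  toFun f := (π f).toLin x
  map_add' f g := by rw [map_add]; rfl
  map_smul' c f := by rw [map_smul]; rfl

/-- The functional `f ↦ (π(f)x, x')`. -/
noncomputable def applyWeak (π : C₀(X, ℝ) →ₗ[ℝ] RegularOp E E) (x : E) (x' : RegularOp E ℝ) :
    C₀(X, ℝ) →ₗ[ℝ] ℝ := x'.toLin ∘ₗ applyVec π x

include hE hπ

lemma exists_sup_precedesSet (V : Set X) :
    ∃ T ∈ upperBounds {T | ∃ f : C₀(X, ℝ), PrecedesSet f V ∧ T = π f},
      T.toSOT ∈ closure (RegularOp.toSOT '' {T | ∃ f : C₀(X, ℝ), PrecedesSet f V ∧ T = π f}) := by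
  refine RegularOp.exists_upperBound_mem_closure hE ⟨_, 0, precedesSet_zero V, rfl⟩ ?_ ?_ ?_
  · rintro _ ⟨f, hf, rfl⟩ _ ⟨g, hg, rfl⟩
    obtain ⟨h, hh, hfh, hgh⟩ := hf.exists_ge hg
    refine ⟨_, ⟨h, hh, rfl⟩, ?_, ?_⟩
    · refine sub_nonneg.1 ?_
      rw [← map_sub]
      exact hπ _ fun x => sub_nonneg.2 (hfh x)
    · refine sub_nonneg.1 ?_
      rw [← map_sub]
      exact hπ _ fun x => sub_nonneg.2 (hgh x)
  · rintro _ ⟨f, hf, rfl⟩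
    exact hπ f fun x => (hf.2.1 x).1
  · intro x hx
    obtain ⟨C, hC0, hC⟩ := exists_bound_of_positive (Φ := applyVec π x) fun f hf => hπ f hf x hx
    refine ⟨C, ?_⟩
    rintro _ ⟨f, hf, rfl⟩
    refine (hC f fun x => (hf.2.1 x).1).trans (mul_le_of_le_one_right hC0 ?_)
    refine ZeroAtInfty.norm_le_of_forall zero_le_one fun x => ?_
    rw [abs_of_nonneg (hf.2.1 x).1]
    exact (hf.2.1 x).2

omit hE in
/-- The representing measures of the functionals `f ↦ (π(f)x, x')` on `C_c(X)`. -/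
lemma exists_regular_measure {x : E} {x' : RegularOp E ℝ} (hx : 0 ≤ x) (hx' : 0 ≤ x')
    {B : RegularOp E E} (hB : ∀ f : C₀(X, ℝ), PrecedesSet f Set.univ → π f ≤ B) :
    ∃ m : Measure X, IsFiniteMeasure m ∧ m.Regular ∧
      ∀ f : C₀(X, ℝ), HasCompactSupport f → ∫ a, f a ∂m = x'.toLin ((π f).toLin x) := by
  let ι : CompactlySupportedContinuousMap X ℝ →ₗ[ℝ] C₀(X, ℝ) :=
    { toFun := fun f => ⟨f.toContinuousMap, HasCompactSupport.is_zero_at_infty f.hasCompactSupport⟩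
      map_add' := fun _ _ => rfl
      map_smul' := fun _ _ => rfl }
  let Λ : CompactlySupportedContinuousMap X ℝ →ₚ[ℝ] ℝ :=
    PositiveLinearMap.mk₀ (applyWeak π x x' ∘ₗ ι) fun f hf =>
      RegularOp.functional_nonneg hx' (hπ (ι f) hf x hx)
  have hΛ : ∀ f : C₀(X, ℝ), HasCompactSupport f →
      ∫ a, f a ∂(RealRMK.rieszMeasure Λ) = x'.toLin ((π f).toLin x) := fun f hf =>
    RealRMK.integral_rieszMeasure Λ ⟨f.toContinuousMap, hf⟩
  refine ⟨RealRMK.rieszMeasure Λ, ⟨?_⟩, inferInstance, hΛ⟩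
  -- Each compact `K` has measure at most `∫ f = (π(f)x, x') ≤ (Bx, x')` for some `f` with `K ≺ f`,
  -- so inner regularity bounds the total mass.
  rw [isOpen_univ.measure_eq_iSup_isCompact]
  refine lt_of_le_of_lt (iSup₂_le fun K _ => iSup_le fun hK => ?_)
    (ENNReal.ofReal_lt_top (r := x'.toLin (B.toLin x)))
  obtain ⟨f, hKf, hf⟩ := exists_setPrecedes_precedesSet hK isOpen_univ (Set.subset_univ K)
  have hint : Integrable f (RealRMK.rieszMeasure Λ) :=
    f.continuous.integrable_of_hasCompactSupport hf.1
  calc RealRMK.rieszMeasure Λ K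
      ≤ ∫⁻ a, ENNReal.ofReal (f a) ∂(RealRMK.rieszMeasure Λ) :=
        meas_le_lintegral₀ f.continuous.measurable.ennreal_ofReal.aemeasurable fun a ha => by
          simp [hKf.2.2 a ha]
    _ = ENNReal.ofReal (∫ a, f a ∂(RealRMK.rieszMeasure Λ)) :=
        (ofReal_integral_eq_lintegral_ofReal hint
          (Eventually.of_forall fun a => (hf.2.1 a).1)).symm
    _ ≤ _ := by
        rw [hΛ f hf.1]
        exact ENNReal.ofReal_le_ofReal (RegularOp.functional_mono hx' (hB f hf x hx))

/-- A single set function serves all positive pairs, because the Riesz recipe is carried out in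
`L_r(E)`. Suprema `w` and infima `v` are over directed sets, so they commute with each pairing and
reproduce there the values of the scalar Riesz measure. -/
lemma exists_operator_values : ∃ v : Set X → RegularOp E E,
    ∀ (x : E) (x' : RegularOp E ℝ), 0 ≤ x → 0 ≤ x' → ∃ m : Measure X, IsFiniteMeasure m ∧
      m.Regular ∧ (∀ A, m.real A = x'.toLin ((v A).toLin x)) ∧
      ∀ f : C₀(X, ℝ), HasCompactSupport f → ∫ a, f a ∂m = x'.toLin ((π f).toLin x) := by
  choose w hw hwc using exists_sup_precedesSet hE hπ
  have hw0 : ∀ V, 0 ≤ w V := fun V => by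
    have := hw V ⟨0, precedesSet_zero V, rfl⟩
    rwa [map_zero] at this
  have hwmono : ∀ {V W : Set X}, V ⊆ W → w V ≤ w W := fun {V W} hVW => by
    refine (RegularOp.isLUB_of_mem_closure (hw V) (hwc V)).2 ?_
    rintro _ ⟨f, hf, rfl⟩
    exact hw W ⟨f, ⟨hf.1, hf.2.1, hf.2.2.trans hVW⟩, rfl⟩
  have hinf : ∀ A : Set X, ∃ T ∈ lowerBounds {T | ∃ V, IsOpen V ∧ A ⊆ V ∧ T = w V},
      T.toSOT ∈ closure (RegularOp.toSOT '' {T | ∃ V, IsOpen V ∧ A ⊆ V ∧ T = w V}) := by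
    intro A
    refine RegularOp.exists_lowerBound_mem_closure hE
      ⟨_, Set.univ, isOpen_univ, Set.subset_univ A, rfl⟩ ?_ ?_
    · rintro _ ⟨V, hV, hAV, rfl⟩ _ ⟨W, hW, hAW, rfl⟩
      exact ⟨_, ⟨V ∩ W, hV.inter hW, Set.subset_inter hAV hAW, rfl⟩,
        hwmono Set.inter_subset_left, hwmono Set.inter_subset_right⟩
    · rintro _ ⟨V, -, -, rfl⟩
      exact hw0 V
  choose v hv hvc using hinf
  refine ⟨v, fun x x' hx hx' => ?_⟩
  obtain ⟨m, hm, hmr, hmf⟩ := exists_regular_measure hπ hx hx'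
    (fun f hf => hw Set.univ ⟨f, hf, rfl⟩)
  refine ⟨m, hm, hmr, fun A => ?_, hmf⟩
  have hopen : ∀ V, IsOpen V → m.real V = x'.toLin ((w V).toLin x) := by
    intro V hV
    have hset : {r | ∃ f : C₀(X, ℝ), PrecedesSet f V ∧ r = ∫ a, f a ∂m}
        = (fun R : RegularOp E E => x'.toLin (R.toLin x)) ''
          {T | ∃ f : C₀(X, ℝ), PrecedesSet f V ∧ T = π f} := by
      ext r
      constructor
      · rintro ⟨f, hf, rfl⟩
        exact ⟨_, ⟨f, hf, rfl⟩, (hmf f hf.1).symm⟩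
      · rintro ⟨_, ⟨f, hf, rfl⟩, rfl⟩
        exact ⟨f, hf, (hmf f hf.1).symm⟩
    refine (isLUB_integral_precedesSet hV).unique ?_
    rw [hset]
    exact RegularOp.isLUB_weak (hw V) (hwc V) hx hx'
  have hset : {r | ∃ V, IsOpen V ∧ A ⊆ V ∧ r = m.real V}
      = (fun R : RegularOp E E => x'.toLin (R.toLin x)) ''
        {T | ∃ V, IsOpen V ∧ A ⊆ V ∧ T = w V} := by
    ext r
    constructor
    · rintro ⟨V, hV, hAV, rfl⟩
      exact ⟨_, ⟨V, hV, hAV, rfl⟩, (hopen V hV).symm⟩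
    · rintro ⟨_, ⟨V, hV, hAV, rfl⟩, rfl⟩
      exact ⟨V, hV, hAV, (hopen V hV).symm⟩
  refine (isGLB_real_isOpen A).unique ?_
  rw [hset]
  exact RegularOp.isGLB_weak (hv A) (hvc A) hx hx'

/-- The existence of a finite regular Borel measure that represents `π` weakly. -/
lemma exists_posMeasure : ∃ (μ : PosMeasure X (RegularOp E E)) (hμ : μ.IsFinite),
    μ.IsRegularBorel ∧ ∀ (x : E) (x' : RegularOp E ℝ), 0 ≤ x → 0 ≤ x' →
      ∀ f : C₀(X, ℝ), HasCompactSupport f →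
        x'.toLin ((π f).toLin x) = ∫ a, f a ∂(μ.weak hE hμ x x') := by
  classical
  obtain ⟨v, hv⟩ := exists_operator_values hE hπ
  have hv0 : ∀ A, 0 ≤ v A := fun A => RegularOp.le_of_forall fun x x' hx hx' => by
    obtain ⟨m, -, -, hm, -⟩ := hv x x' hx hx'
    rw [← hm A]
    simp [measureReal_nonneg]
  let μ : PosMeasure X (RegularOp E E) :=
    { toFun := fun A => if MeasurableSet A then (v A : WithTop _) else 0
      nonneg' := fun A => by
        split_ifs
        · exact WithTop.coe_le_coe.2 (hv0 A)
        · exact le_rfl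
      empty' := by
        rw [if_pos MeasurableSet.empty]
        refine WithTop.coe_eq_zero.2 (RegularOp.eq_of_forall fun x x' hx hx' => ?_)
        obtain ⟨m, -, -, hm, -⟩ := hv x x' hx hx'
        rw [← hm ∅]
        simp
      not_measurable' := fun A hA => if_neg hA
      iUnion' := fun Δ hΔ hd => by
        simp only [if_pos (hΔ _), if_pos (MeasurableSet.iUnion hΔ), ← WithTop.coe_sum]
        have hset : (Set.range fun N => ((∑ n ∈ Finset.range N, v (Δ n) : RegularOp E E) :
            WithTop (RegularOp E E))) = (fun T : RegularOp E E => (T : WithTop _)) ''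
            Set.range fun N => ∑ n ∈ Finset.range N, v (Δ n) := by
          rw [← Set.range_comp]
          rfl
        rw [hset, isLUB_image_coe]
        -- Operator σ-additivity is a supremum, so it may be checked under pairings, where it is the
        -- σ-additivity of `m`.
        refine RegularOp.isLUB_of_forall fun x x' hx hx' => ?_
        obtain ⟨m, hfin, -, hm, -⟩ := hv x x' hx hx'
        rw [← Set.range_comp]
        simp only [Function.comp_def, PosMeasure.toLin_sum, map_sum, ← hm]
        have hs : HasSum (fun n => m.real (Δ n)) (m.real (⋃ n, Δ n)) := by
          have := m.toSignedMeasure.m_iUnion hΔ hd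
          simpa [hΔ, MeasurableSet.iUnion hΔ] using this
        exact isLUB_of_tendsto_atTop (fun M N hMN => Finset.sum_le_sum_of_subset_of_nonneg
          (Finset.range_mono hMN) fun n _ _ => measureReal_nonneg) hs.tendsto_sum_nat }
  have hμA : ∀ {A}, MeasurableSet A → μ A = (v A : WithTop _) := fun hA => if_pos hA
  have hval : ∀ {A}, MeasurableSet A → μ.val A = v A := fun hA => by
    rw [PosMeasure.val, hμA hA]
    rfl
  have hμ : μ.IsFinite := by
    rw [PosMeasure.IsFinite, hμA MeasurableSet.univ]
    exact WithTop.coe_ne_top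
  refine ⟨μ, hμ, ⟨fun K _ => μ.ne_top hμ K, fun V hV => ?_, fun A hA => ?_⟩, ?_⟩
  · have : {y | ∃ K, IsCompact K ∧ K ⊆ V ∧ y = μ K}
        = (fun T : RegularOp E E => (T : WithTop _)) ''
          {T | ∃ K, IsCompact K ∧ K ⊆ V ∧ T = v K} := by
      ext y
      constructor
      · rintro ⟨K, hK, hKV, rfl⟩
        exact ⟨_, ⟨K, hK, hKV, rfl⟩, (hμA hK.measurableSet).symm⟩
      · rintro ⟨_, ⟨K, hK, hKV, rfl⟩, rfl⟩
        exact ⟨K, hK, hKV, (hμA hK.measurableSet).symm⟩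
    rw [this, hμA hV.measurableSet, isLUB_image_coe]
    refine RegularOp.isLUB_of_forall fun x x' hx hx' => ?_
    obtain ⟨m, hfin, hr, hm, -⟩ := hv x x' hx hx'
    rw [← hm]
    convert isLUB_real_isCompact (m := m) hV using 1
    ext r
    constructor
    · rintro ⟨_, ⟨K, hK, hKV, rfl⟩, rfl⟩
      exact ⟨K, hK, hKV, (hm K).symm⟩
    · rintro ⟨K, hK, hKV, rfl⟩
      exact ⟨_, ⟨K, hK, hKV, rfl⟩, (hm K).symm⟩
  · have : {y | ∃ V, IsOpen V ∧ A ⊆ V ∧ y = μ V}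
        = (fun T : RegularOp E E => (T : WithTop _)) ''
          {T | ∃ V, IsOpen V ∧ A ⊆ V ∧ T = v V} := by
      ext y
      constructor
      · rintro ⟨V, hV, hAV, rfl⟩
        exact ⟨_, ⟨V, hV, hAV, rfl⟩, (hμA hV.measurableSet).symm⟩
      · rintro ⟨_, ⟨V, hV, hAV, rfl⟩, rfl⟩
        exact ⟨V, hV, hAV, (hμA hV.measurableSet).symm⟩
    have hne : {T | ∃ V, IsOpen V ∧ A ⊆ V ∧ T = v V}.Nonempty :=
      ⟨_, Set.univ, isOpen_univ, Set.subset_univ A, rfl⟩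
    rw [this, hμA hA, isGLB_image_coe hne]
    refine RegularOp.isGLB_of_forall fun x x' hx hx' => ?_
    obtain ⟨m, hfin, hr, hm, -⟩ := hv x x' hx hx'
    rw [← hm]
    convert isGLB_real_isOpen (m := m) A using 1
    ext r
    constructor
    · rintro ⟨_, ⟨V, hV, hAV, rfl⟩, rfl⟩
      exact ⟨V, hV, hAV, (hm V).symm⟩
    · rintro ⟨V, hV, hAV, rfl⟩
      exact ⟨_, ⟨V, hV, hAV, rfl⟩, (hm V).symm⟩
  · intro x x' hx hx' f hf
    obtain ⟨m, hfin, hr, hm, hmf⟩ := hv x x' hx hx'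
    have : μ.weak hE hμ x x' = m := by
      ext A hA
      rw [μ.weak_apply hE hμ hx hx' hA, hval hA, ← hm, ofReal_measureReal]
    rw [this, hmf f hf]

end Construction

/-! ### Finiteness and uniqueness of a representing measure -/

namespace PosMeasure

section Restrict

variable {X F : Type*} [MeasurableSpace X] [AddCommGroup F] [PartialOrder F]
  [IsOrderedAddMonoid F] [Module ℝ F]

open Classical in
/-- The restriction of a measure to a measurable set. -/
noncomputable def restrict (μ : PosMeasure X F) {K : Set X} (hK : MeasurableSet K) :
    PosMeasure X F where
  toFun A := if MeasurableSet A then μ (A ∩ K) else 0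
  nonneg' A := by
    split_ifs
    · exact μ.nonneg' _
    · exact le_rfl
  empty' := by
    rw [if_pos MeasurableSet.empty, Set.empty_inter]
    exact μ.empty'
  not_measurable' A hA := if_neg hA
  iUnion' Δ hΔ hd := by
    simp only [if_pos (hΔ _), if_pos (MeasurableSet.iUnion hΔ), Set.iUnion_inter]
    exact μ.iUnion' _ (fun n => (hΔ n).inter hK)
      fun i j hij => (hd hij).mono Set.inter_subset_left Set.inter_subset_left

lemma restrict_apply (μ : PosMeasure X F) {K : Set X} (hK : MeasurableSet K) {A : Set X}
    (hA : MeasurableSet A) : μ.restrict hK A = μ (A ∩ K) := if_pos hA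

lemma extSMul_zero_left (a : WithTop F) : extSMul 0 a = 0 := by
  induction a using WithTop.recTopCoe with
  | top => exact if_pos rfl
  | coe a =>
    change (((((0 : ℝ≥0) : ℝ) • a : F)) : WithTop F) = 0
    simp

lemma elemIntegral_of_eq_zero (μ : PosMeasure X F) {φ : SimpleFunc X ℝ≥0} (h : ∀ x, φ x = 0) :
    μ.elemIntegral φ = 0 := by
  refine Finset.sum_eq_zero fun r hr => ?_
  obtain ⟨x, rfl⟩ := SimpleFunc.mem_range.1 hr
  rw [h x, extSMul_zero_left]

/-- This covers possibly infinite measures, for which existence of order integrals has not been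
established: the default `⊤` of `lintegral` also becomes `0` under `untopD 0`. -/
lemma untopD_lintegral_zero (μ : PosMeasure X F) : (μ.lintegral fun _ => 0).untopD 0 = 0 := by
  rw [lintegral]
  split_ifs with h
  · obtain ⟨φ, -, hφ, hy⟩ := h.choose_spec
    have h0 : ∀ n x, φ n x = 0 := fun n x => by
      have := le_iSup (fun n => (φ n x : ℝ≥0∞)) n
      rw [hφ x] at this
      simpa using this
    simp only [μ.elemIntegral_of_eq_zero (h0 _), Set.range_const] at hy
    rw [hy.unique isLUB_singleton]
    rfl
  · rfl

end Restrict

variable {X : Type*} [MeasurableSpace X]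
  {E : Type*} [NormedAddCommGroup E] [Lattice E] [IsOrderedAddMonoid E] [HasSolidNorm E]
  [NormedSpace ℝ E] [PosSMulMono ℝ E] [CompleteSpace E]

lemma extSMul_mono (r : ℝ≥0) {a b : WithTop (RegularOp E E)} (h : a ≤ b) :
    extSMul r a ≤ extSMul r b := by
  rcases eq_or_ne r 0 with rfl | hr
  · rw [extSMul_zero_left, extSMul_zero_left]
  induction b using WithTop.recTopCoe with
  | top =>
    have : extSMul r (⊤ : WithTop (RegularOp E E)) = ⊤ := if_neg hr
    rw [this]
    exact le_top
  | coe b =>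
    induction a using WithTop.recTopCoe with
    | top => exact absurd h (WithTop.not_top_le_coe b)
    | coe a =>
      refine WithTop.coe_le_coe.2 fun x hx => ?_
      exact smul_le_smul_of_nonneg_left (WithTop.coe_le_coe.1 h x hx) r.2

lemma elemIntegral_restrict_le (μ : PosMeasure X (RegularOp E E)) {K : Set X}
    (hK : MeasurableSet K) (φ : SimpleFunc X ℝ≥0) :
    (μ.restrict hK).elemIntegral φ ≤ μ.elemIntegral φ := by
  refine Finset.sum_le_sum fun r _ => extSMul_mono r ?_
  have hm := φ.measurableSet_preimage {r}
  rw [μ.restrict_apply hK hm]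
  exact μ.mono (hm.inter hK) hm Set.inter_subset_left

/-- If the order integral of `f` is finite and `f ≥ 1` on a set of finite measure, then this
measure is at most the order integral. -/
lemma HasOrderIntegral.le_of_one_le {μ : PosMeasure X (RegularOp E E)} (hE : IsKBSpace E)
    {f : X → ℝ≥0∞} {T : RegularOp E E} (h : μ.HasOrderIntegral f (T : WithTop _)) {K : Set X}
    (hK : MeasurableSet K) (hμK : μ K ≠ ⊤) (hf : ∀ a ∈ K, 1 ≤ f a) : μ K ≤ (T : WithTop _) := by
  obtain ⟨φ, hφ, hsup, hT⟩ := h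
  -- Since `μ` may be infinite, its pairings need not be available. Its restriction to `K` is
  -- finite, with smaller elementary integrals.
  have hfin : (μ.restrict hK).IsFinite := by
    rwa [IsFinite, μ.restrict_apply hK MeasurableSet.univ, Set.univ_inter]
  have hle : ∀ n, (μ.restrict hK).elemVal (φ n) ≤ T := fun n => by
    rw [← WithTop.coe_le_coe, ← elemIntegral_eq _ hfin]
    exact (μ.elemIntegral_restrict_le hK _).trans (hT.1 ⟨n, rfl⟩)
  have hT0 : 0 ≤ T := ((μ.restrict hK).elemVal_nonneg (φ 0)).trans (hle 0)
  have hval : μ K = ((μ.restrict hK).val K : WithTop _) := by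
    rw [coe_val _ (ne_top _ hfin K), μ.restrict_apply hK hK, Set.inter_self]
  rw [hval, WithTop.coe_le_coe]
  refine RegularOp.le_of_forall fun x x' hx hx' => ?_
  rw [← ENNReal.ofReal_le_ofReal_iff (RegularOp.functional_nonneg hx' (hT0 x hx)),
    ← weak_apply _ hE hfin hx hx' hK]
  refine (meas_le_lintegral₀ (f := f) ?_ hf).trans ?_
  · have : f = fun a => ⨆ n, (φ n a : ℝ≥0∞) := funext fun a => (hsup a).symm
    rw [this]
    exact (Measurable.iSup fun n => (φ n).measurable.coe_nnreal_ennreal).aemeasurable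
  · rw [lintegral_weak_eq_iSup _ hE hfin hφ hsup hx hx']
    exact iSup_le fun n => ENNReal.ofReal_le_ofReal
      (RegularOp.functional_mono hx' (hle n x hx))

variable [TopologicalSpace X] [LocallyCompactSpace X] [T2Space X] [BorelSpace X]

/-- Uniqueness is among all regular Borel measures, so finiteness must be derived. For `K ≺ f` one
has `μ(K) ≤ ∫ f dμ = π(f) ≤ B`, and inner regularity gives `μ(X) ≤ B`. -/
lemma Represents.isFinite {μ : PosMeasure X (RegularOp E E)} (hE : IsKBSpace E)
    {π : C₀(X, ℝ) →ₗ[ℝ] RegularOp E E} (h : μ.Represents π) (hr : μ.IsRegularBorel)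
    {B : RegularOp E E} (hB : ∀ f : C₀(X, ℝ), PrecedesSet f Set.univ → π f ≤ B) :
    μ.IsFinite := by
  refine ne_top_of_le_ne_top (WithTop.coe_ne_top (a := B))
    ((hr.innerRegular Set.univ isOpen_univ).2 ?_)
  rintro _ ⟨K, hK, -, rfl⟩
  obtain ⟨f, hKf, hf⟩ := exists_setPrecedes_precedesSet hK isOpen_univ (Set.subset_univ K)
  refine le_trans ?_ (WithTop.coe_le_coe.2 (hB f hf))
  obtain ⟨hL, hfπ⟩ := h f hf.1
  have hneg : (fun a => ENNReal.ofReal (-f a)) = fun _ => 0 := funext fun a =>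
    ENNReal.ofReal_of_nonpos (neg_nonpos.2 (hf.2.1 a).1)
  have habs : (fun a => ENNReal.ofReal |f a|) = fun a => ENNReal.ofReal (f a) := funext fun a => by
    rw [abs_of_nonneg (hf.2.1 a).1]
  have hne := hL.2
  rw [integral, hneg, untopD_lintegral_zero, sub_zero] at hfπ
  rw [habs] at hne
  have hI : μ.HasOrderIntegral (fun a => ENNReal.ofReal (f a)) (π f : WithTop _) := by
    rw [hfπ]
    -- If no order integral existed, `lintegral` would be `⊤` by default, contrary to `f ∈ μ.L1`.
    have hex : ∃ y, μ.HasOrderIntegral (fun a => ENNReal.ofReal (f a)) y := by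
      by_contra hex
      exact hne (dif_neg hex)
    have hs := hex.choose_spec
    have heq : μ.lintegral (fun a => ENNReal.ofReal (f a)) = hex.choose := dif_pos hex
    rw [← heq] at hs
    generalize μ.lintegral (fun a => ENNReal.ofReal (f a)) = y at hs hne ⊢
    induction y using WithTop.recTopCoe with
    | top => exact absurd rfl hne
    | coe y => exact hs
  exact hI.le_of_one_le hE hK.measurableSet (hr.finite_of_isCompact K hK) fun a ha => by
    simp [hKf.2.2 a ha]

/-- The uniqueness of the finite regular Borel measure that represents a given operator. -/
lemma Represents.unique {μ μ' : PosMeasure X (RegularOp E E)} (hE : IsKBSpace E)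
    {π : C₀(X, ℝ) →ₗ[ℝ] RegularOp E E} (h : μ.Represents π) (h' : μ'.Represents π)
    (hμ : μ.IsFinite) (hμ' : μ'.IsFinite) (hr : μ.IsRegularBorel) (hr' : μ'.IsRegularBorel) :
    μ = μ' := by
  refine ext_val hμ hμ' fun A hA => RegularOp.eq_of_forall fun x x' hx hx' => ?_
  have := hr.regular_weak hE hμ hx hx'
  have := hr'.regular_weak hE hμ' hx hx'
  have heq : μ.weak hE hμ x x' = μ'.weak hE hμ' x x' := by
    refine Measure.ext_of_integral_eq_on_compactlySupported fun f => ?_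
    let g : C₀(X, ℝ) := ⟨f.toContinuousMap,
      HasCompactSupport.is_zero_at_infty f.hasCompactSupport⟩
    have h1 := h g f.hasCompactSupport
    have h2 := h' g f.hasCompactSupport
    have e1 := functional_integral hE hμ h1.1 hx hx'
    have e2 := functional_integral hE hμ' h2.1 hx hx'
    rw [← h1.2] at e1
    rw [← h2.2] at e2
    exact e1.symm.trans e2
  rw [← μ.weak_real hE hμ hx hx' hA, heq, μ'.weak_real hE hμ' hx hx' hA]

/-! ### Values on open and compact sets, and the generated subspaces -/

section Representing

variable {μ : PosMeasure X (RegularOp E E)} (hE : IsKBSpace E) (hμ : μ.IsFinite)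
  {π : C₀(X, ℝ) →ₗ[ℝ] RegularOp E E}
  (hint : ∀ f : C₀(X, ℝ), ⇑f ∈ μ.L1 ∧ π f = μ.integral f) (hr : μ.IsRegularBorel)

include hμ hint

include hE in
lemma functional_eq_integral {x : E} {x' : RegularOp E ℝ} (hx : 0 ≤ x) (hx' : 0 ≤ x')
    (f : C₀(X, ℝ)) :
    x'.toLin ((π f).toLin x) = ∫ a, f a ∂(μ.weak hE hμ x x') := by
  rw [(hint f).2, functional_integral hE hμ (hint f).1 hx hx']

include hE hr

lemma isLUB_precedesSet {V : Set X} (hV : IsOpen V) :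
    IsLUB {T | ∃ f : C₀(X, ℝ), PrecedesSet f V ∧ T = π f} (μ.val V) := by
  refine RegularOp.isLUB_of_forall fun x x' hx hx' => ?_
  have := hr.regular_weak hE hμ hx hx'
  have hset : {r | ∃ f : C₀(X, ℝ), PrecedesSet f V ∧ r = ∫ a, f a ∂(μ.weak hE hμ x x')}
      = (fun R : RegularOp E E => x'.toLin (R.toLin x)) ''
        {T | ∃ f : C₀(X, ℝ), PrecedesSet f V ∧ T = π f} := by
    ext r
    constructor
    · rintro ⟨f, hf, rfl⟩
      exact ⟨_, ⟨f, hf, rfl⟩, functional_eq_integral hE hμ hint hx hx' f⟩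
    · rintro ⟨_, ⟨f, hf, rfl⟩, rfl⟩
      exact ⟨f, hf, functional_eq_integral hE hμ hint hx hx' f⟩
  rw [← hset, ← μ.weak_real hE hμ hx hx' hV.measurableSet]
  exact isLUB_integral_precedesSet hV

lemma isGLB_setPrecedes {K : Set X} (hK : IsCompact K) :
    IsGLB {T | ∃ f : C₀(X, ℝ), SetPrecedes K f ∧ T = π f} (μ.val K) := by
  refine RegularOp.isGLB_of_forall fun x x' hx hx' => ?_
  have := hr.regular_weak hE hμ hx hx'
  have hset : {r | ∃ f : C₀(X, ℝ), SetPrecedes K f ∧ r = ∫ a, f a ∂(μ.weak hE hμ x x')}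
      = (fun R : RegularOp E E => x'.toLin (R.toLin x)) ''
        {T | ∃ f : C₀(X, ℝ), SetPrecedes K f ∧ T = π f} := by
    ext r
    constructor
    · rintro ⟨f, hf, rfl⟩
      exact ⟨_, ⟨f, hf, rfl⟩, functional_eq_integral hE hμ hint hx hx' f⟩
    · rintro ⟨_, ⟨f, hf, rfl⟩, rfl⟩
      exact ⟨f, hf, functional_eq_integral hE hμ hint hx hx' f⟩
  rw [← hset, ← μ.weak_real hE hμ hx hx' hK.measurableSet]
  exact isGLB_integral_setPrecedes hK

/-- The inclusions close up in the cycle `L1 ≤ L2 ≤ L3 ≤ L4 ≤ L7 ≤ L5 ≤ L1`, with `L6` inserted by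
`L5 ≤ L6 ≤ L7`. The inclusions that are not immediate use that integrals, outer and inner
approximations, and suprema of `π(f)` over `f ≺ V` are strong limits. -/
lemma exists_sotSpan_eq (hπ : ∀ f : C₀(X, ℝ), (∀ x, 0 ≤ f x) → 0 ≤ π f) :
    ∃ L : Submodule ℝ (E →Lₚₜ[ℝ] E),
      sotSpan {T | ∃ f : C₀(X, ℝ), HasCompactSupport f ∧ T = π f} = L ∧
      sotSpan {T | ∃ f : C₀(X, ℝ), T = π f} = L ∧
      sotSpan {T | ∃ f : X → ℝ, Measurable f ∧ (∃ M : ℝ, ∀ x, |f x| ≤ M) ∧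
        T = μ.integral f} = L ∧
      sotSpan {T | ∃ f ∈ μ.L1, T = μ.integral f} = L ∧
      sotSpan {T | ∃ V : Set X, IsOpen V ∧ T = μ.val V} = L ∧
      sotSpan {T | ∃ K : Set X, IsCompact K ∧ T = μ.val K} = L ∧
      sotSpan {T | ∃ Δ : Set X, MeasurableSet Δ ∧ T = μ.val Δ} = L := by
  have hcl : ∀ S : Set (RegularOp E E), IsClosed (sotSpan S : Set (E →Lₚₜ[ℝ] E)) :=
    fun S => Submodule.isClosed_topologicalClosure _
  have hlim : ∀ {S S' : Set (RegularOp E E)} {T : RegularOp E E}, S' ⊆ S →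
      T.toSOT ∈ closure (RegularOp.toSOT '' S') → T.toSOT ∈ sotSpan S := by
    intro S S' T hS hT
    refine (hcl S).closure_subset_iff.2 ?_ hT
    rintro _ ⟨R, hR, rfl⟩
    exact toSOT_mem_sotSpan (hS hR)
  set L1 := sotSpan {T | ∃ f : C₀(X, ℝ), HasCompactSupport f ∧ T = π f} with hL1
  set L2 := sotSpan {T | ∃ f : C₀(X, ℝ), T = π f} with hL2
  set L3 := sotSpan {T | ∃ f : X → ℝ, Measurable f ∧ (∃ M : ℝ, ∀ x, |f x| ≤ M) ∧
        T = μ.integral f} with hL3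
  set L4 := sotSpan {T | ∃ f ∈ μ.L1, T = μ.integral f} with hL4
  set L5 := sotSpan {T | ∃ V : Set X, IsOpen V ∧ T = μ.val V} with hL5
  set L6 := sotSpan {T | ∃ K : Set X, IsCompact K ∧ T = μ.val K} with hL6
  set L7 := sotSpan {T | ∃ Δ : Set X, MeasurableSet Δ ∧ T = μ.val Δ} with hL7
  have h12 : L1 ≤ L2 := sotSpan_le (hcl _) (by
    rintro _ ⟨f, -, rfl⟩
    exact toSOT_mem_sotSpan ⟨f, rfl⟩)
  have h23 : L2 ≤ L3 := sotSpan_le (hcl _) (by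
    rintro _ ⟨f, rfl⟩
    have hb : ∃ M : ℝ, ∀ x, |f x| ≤ M := ⟨‖f‖, ZeroAtInfty.abs_le_norm f⟩
    exact toSOT_mem_sotSpan ⟨f, (hint f).1.1, hb, (hint f).2⟩)
  have h34 : L3 ≤ L4 := sotSpan_le (hcl _) (by
    rintro _ ⟨f, hf, ⟨M, hM⟩, rfl⟩
    exact toSOT_mem_sotSpan ⟨f, μ.mem_L1_of_bounded hE hμ hf hM, rfl⟩)
  have h47 : L4 ≤ L7 := sotSpan_le (hcl _) (by
    rintro _ ⟨f, hf, rfl⟩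
    exact toSOT_integral_mem (L := L7) hE hμ (hcl _) (fun A hA => toSOT_mem_sotSpan ⟨A, hA, rfl⟩) hf)
  have h75 : L7 ≤ L5 := sotSpan_le (hcl _) (by
    rintro _ ⟨A, hA, rfl⟩
    refine hlim ?_ (hr.mem_closure_isOpen hE hμ hA)
    rintro _ ⟨V, hV, -, rfl⟩
    exact ⟨V, hV, rfl⟩)
  have h51 : L5 ≤ L1 := sotSpan_le (hcl _) (by
    rintro _ ⟨V, hV, rfl⟩
    obtain ⟨T, hT, hTc⟩ := exists_sup_precedesSet hE hπ V
    rw [(isLUB_precedesSet hE hμ hint hr hV).unique (RegularOp.isLUB_of_mem_closure hT hTc)]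
    refine hlim ?_ hTc
    rintro _ ⟨f, hf, rfl⟩
    exact ⟨f, hf.1, rfl⟩)
  have h56 : L5 ≤ L6 := sotSpan_le (hcl _) (by
    rintro _ ⟨V, hV, rfl⟩
    refine hlim ?_ (hr.mem_closure_isCompact hE hμ hV)
    rintro _ ⟨K, hK, -, rfl⟩
    exact ⟨K, hK, rfl⟩)
  have h67 : L6 ≤ L7 := sotSpan_le (hcl _) (by
    rintro _ ⟨K, hK, rfl⟩
    exact toSOT_mem_sotSpan ⟨K, hK.measurableSet, rfl⟩)
  have h71 : L7 ≤ L1 := h75.trans h51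
  have h17 : L1 ≤ L7 := h12.trans (h23.trans (h34.trans h47))
  exact ⟨L1, rfl, le_antisymm (h23.trans (h34.trans (h47.trans h71))) h12,
    le_antisymm (h34.trans (h47.trans h71)) (h12.trans h23),
    le_antisymm (h47.trans h71) (h12.trans (h23.trans h34)),
    le_antisymm h51 (h17.trans h75), le_antisymm (h67.trans h71) (h17.trans (h75.trans h56)),
    le_antisymm h71 h17⟩

end Representing

end PosMeasure

end OrderRiesz

theorem mainTheorem6
    {X : Type*} [TopologicalSpace X] [LocallyCompactSpace X] [T2Space X]
    [MeasurableSpace X] [BorelSpace X]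
    {E : Type*} [NormedAddCommGroup E] [Lattice E] [IsOrderedAddMonoid E] [HasSolidNorm E]
    [NormedSpace ℝ E] [PosSMulMono ℝ E] [CompleteSpace E]
    (hE : IsKBSpace E)
    (π : C₀(X, ℝ) →ₗ[ℝ] RegularOp E E)
    (hπ : ∀ f : C₀(X, ℝ), (∀ x, 0 ≤ f x) → 0 ≤ π f) :
    ∃ μ : PosMeasure X (RegularOp E E),
      -- `μ` is the unique representing regular Borel measure, and it is finite
      (μ.IsRegularBorel ∧ μ.Represents π) ∧
      (∀ μ' : PosMeasure X (RegularOp E E),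
        μ'.IsRegularBorel → μ'.Represents π → μ' = μ) ∧
      μ.IsFinite ∧
      (∀ f : C₀(X, ℝ), ⇑f ∈ μ.L1 ∧ π f = μ.integral f) ∧
      -- the measures of open and of compact sets
      (∀ V : Set X, IsOpen V → V.Nonempty →
        IsLUB {T | ∃ f : C₀(X, ℝ), PrecedesSet f V ∧ T = π f} (μ.val V)) ∧
      (∀ K : Set X, IsCompact K →
        IsGLB {T | ∃ f : C₀(X, ℝ), SetPrecedes K f ∧ T = π f} (μ.val K)) ∧
      -- strong σ-additivity
      (∀ Δ : ℕ → Set X, (∀ n, MeasurableSet (Δ n)) →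
        Pairwise (fun i j => Disjoint (Δ i) (Δ j)) →
        ∀ x : E, HasSum (fun n => (μ.val (Δ n)).toLin x) ((μ.val (⋃ n, Δ n)).toLin x)) ∧
      -- the measures `μ_{x,x'}` and the weak description of the extension of `π` to `𝓛¹`
      (∃ ν : E → RegularOp E ℝ → SignedMeasure X,
        (∀ x x' Δ, MeasurableSet Δ → ν x x' Δ = x'.toLin ((μ.val Δ).toLin x)) ∧
        (∀ x x', (ν x x').variation.Regular) ∧
        (∀ x x', 0 ≤ x → 0 ≤ x' → 0 ≤ ν x x') ∧
        ∀ f ∈ μ.L1,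
          (∀ x x', (ν x x').Integrable f ∧
            x'.toLin ((μ.integral f).toLin x) = ∫ᵛ y, f y ∂<•(ν x x')) ∧
          ∀ T : RegularOp E E,
            (∀ x x', 0 ≤ x → 0 ≤ x' → x'.toLin (T.toLin x) = ∫ᵛ y, f y ∂<•(ν x x')) →
            T = μ.integral f) ∧
      -- the seven generated SOT-closed subspaces coincide
      (∀ f : X → ℝ, Measurable f → (∃ M : ℝ, ∀ x, |f x| ≤ M) → f ∈ μ.L1) ∧
      (∃ L : Submodule ℝ (E →Lₚₜ[ℝ] E),
        sotSpan {T | ∃ f : C₀(X, ℝ), HasCompactSupport f ∧ T = π f} = L ∧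
        sotSpan {T | ∃ f : C₀(X, ℝ), T = π f} = L ∧
        sotSpan {T | ∃ f : X → ℝ, Measurable f ∧ (∃ M : ℝ, ∀ x, |f x| ≤ M) ∧
          T = μ.integral f} = L ∧
        sotSpan {T | ∃ f ∈ μ.L1, T = μ.integral f} = L ∧
        sotSpan {T | ∃ V : Set X, IsOpen V ∧ T = μ.val V} = L ∧
        sotSpan {T | ∃ K : Set X, IsCompact K ∧ T = μ.val K} = L ∧
        sotSpan {T | ∃ Δ : Set X, MeasurableSet Δ ∧ T = μ.val Δ} = L) := by
  obtain ⟨μ, hμ, hr, hw⟩ := exists_posMeasure hE hπ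
  have hint : ∀ f : C₀(X, ℝ), ⇑f ∈ μ.L1 ∧ π f = μ.integral f := by
    intro f
    have hf := μ.mem_L1_of_bounded hE hμ f.continuous.measurable (ZeroAtInfty.abs_le_norm f)
    refine ⟨hf, PosMeasure.integral_unique hE hμ hf fun x x' hx hx' => ?_⟩
    exact eq_integral_of_hasCompactSupport (Φ := applyWeak π x x')
      (fun g hg => RegularOp.functional_nonneg hx' (hπ g hg x hx)) (hw x x' hx hx') f
  have hrep : μ.Represents π := fun f _ => hint f
  -- This common upper bound of `π(f)` over `f ≺ X` forces every competing representing measure to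
  -- be finite.
  obtain ⟨B, hB, -⟩ := exists_sup_precedesSet hE hπ Set.univ
  refine ⟨μ, ⟨hr, hrep⟩, fun μ' hr' hrep' => ?_, hμ, hint,
    fun V hV _ => PosMeasure.isLUB_precedesSet hE hμ hint hr hV,
    fun K hK => PosMeasure.isGLB_setPrecedes hE hμ hint hr hK,
    fun Δ hΔ hd x => μ.hasSum_val hE hμ hΔ hd x,
    ⟨μ.signed hE hμ, fun x x' Δ _ => rfl, hr.regular_variation hE hμ,
      fun x x' hx hx' => μ.signed_nonneg hE hμ hx hx', fun f hf =>
        ⟨PosMeasure.functional_integral_signed hE hμ hf, fun T hT => ?_⟩⟩,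
    fun f hf hM => hM.elim fun M hM => μ.mem_L1_of_bounded hE hμ hf hM,
    PosMeasure.exists_sotSpan_eq hE hμ hint hr hπ⟩
  · exact hrep'.unique hE hrep (hrep'.isFinite hE hr' fun f hf => hB ⟨f, hf, rfl⟩) hμ hr' hr
  · refine PosMeasure.integral_unique hE hμ hf fun x x' hx hx' => ?_
    rw [hT x x' hx hx', PosMeasure.integral_signed_of_nonneg hE hμ f hx hx']
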